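/- **Setting.** For $j=1,2$ let $\mathcal A_j=(\alpha_j,\delta_j,\dot\alpha_j,\dot\delta_j)\in[-\pi,\pi)\times(-\pi/2,\pi/2)\times\mathbb R^2$ be an attributable and let $\mathbf q_j,\dot{\mathbf q}_j\in\mathbb R^3$ be the position and velocity of the observer. Put $$\mathbf e^\rho_j=(\cos\delta_j\cos\alpha_j,\cos\delta_j\sin\alpha_j,\sin\delta_j),\qquad \mathbf e^\perp_j=\dot\alpha_j\cos\delta_j\,\mathbf e^\alpha_j+\dot\delta_j\,\mathbf e^\delta_j,$$ with $\mathbf e^\alpha_j=(\cos\delta_j)^{-1}\partial\mathbf e^\rho_j/\partial\alpha_j$, $\mathbf e^\delta_j=\partial\mathbf e^\rho_j/\partial\delta_j$, and $$\mathbf D_j=\mathbf q_j\times\mathbf e^\rho_j,\quad \mathbf E_j=\mathbf e^\rho_j\times\mathbf e^\perp_j,\quad \mathbf F_j=\mathbf q_j\times\mathbf e^\perp_j+\mathbf e^\rho_j\times\dot{\mathbf q}_j,\quad \mathbf G_j=\mathbf q_j\times\dot{\mathbf q}_j.$$ With unknowns $\rho_1,\rho_2$ let $$\mathbf J=\mathbf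 E_2\rho_2^2+\mathbf F_2\rho_2+\mathbf G_2-\mathbf E_1\rho_1^2-\mathbf F_1\rho_1-\mathbf G_1,\qquad q=\mathbf J\cdot(\mathbf D_1\times\mathbf D_2),$$ $$\dot\rho_1=\frac{\mathbf J\cdot\mathbf D_2\times(\mathbf D_1\times\mathbf D_2)}{|\mathbf D_1\times\mathbf D_2|^2},\qquad \dot\rho_2=\frac{\mathbf J\cdot\mathbf D_1\times(\mathbf D_1\times\mathbf D_2)}{|\mathbf D_1\times\mathbf D_2|^2}$$ (so that the conservation of angular momentum $\mathbf D_1\dot\rho_1-\mathbf D_2\dot\rho_2=\mathbf J$ holds exactly when $q=0$, if $\mathbf D_1\times\mathbf D_2\neq\mathbf 0$, which is generic), and $$\mathbf r_j=\mathbf q_j+\rho_j\mathbf e^\rho_j,\quad \dot{\mathbf r}_j=\dot{\mathbf q}_j+\dot\rho_j\mathbf e^\rho_j+\rho_j\mathbf e^\perp_j,\quad \mathbf K_j=\tfrac12(\dot{\mathbf r}_j\cdot\dot{\mathbf r}_j)\,\mathbf r_j-(\dot{\mathbf r}_j\cdot\mathbf r_j)\,\dot{\mathbf r}_j,$$ $$\boldsymbol\xi=(\mathbf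 K_1-\mathbf K_2)\times(\mathbf r_1-\mathbf r_2),\qquad p_j=\boldsymbol\xi\cdot\mathbf e^\rho_j,\qquad \mathfrak u_j=\mathrm{res}(p_j,q,\rho_1)\in\mathbb R[\rho_2],$$ where $\mathrm{res}(\cdot,\cdot,\rho_1)$ is the resultant with respect to $\rho_1$; the dot product is bilinear, also for complex $\rho_1,\rho_2$. A property holds *for generic data* if there is a real polynomial $\Psi$ in the 24 components of $\mathbf e^\rho_j,\mathbf e^\perp_j,\mathbf q_j,\dot{\mathbf q}_j$ ($j=1,2$), not identically zero on the set of all data $(\mathcal A_1,\mathcal A_2,\mathbf q_1,\mathbf q_2,\dot{\mathbf q}_1,\dot{\mathbf q}_2)$, such that the property holds for all data with $\Psi\neq0$. **Theorem.** For generic data the following hold. 1. The overdetermined system $q=0$, $\boldsymbol\xi=\mathbf 0$ is consistent, that is, it has a solution $(\rho_1,\rho_2)\in\mathbb C^2$. 2. The polynomials $\mathfrak u_1,\mathfrak u_2$ both have degree $10$, and their greatest common divisor has degree $9$. 3. The system reduces to $\mathfrak u_1=\mathfrak u_2=0$: the map $(\rho_1,\rho_2)\mapsto\rho_2$ is a bijection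 from the set of solutions in $\mathbb C^2$ of $q=0$, $\boldsymbol\xi=\mathbf 0$ onto the set of common complex roots of $\mathfrak u_1$ and $\mathfrak u_2$. 4. The system $q=0$, $\boldsymbol\xi=\mathbf 0$ has exactly $9$ solutions in $\mathbb C^2$. -/

import Mathlib

open scoped Matrix

noncomputable section

namespace Linkage

/-- An attributable `(α, δ, α̇, δ̇)`: angular position and angular rates. -/
structure Attributable where
  α : ℝ
  δ : ℝ
  αdot : ℝ
  δdot : ℝ
  hα : α ∈ Set.Ico (-Real.pi) Real.pi
  hδ : δ ∈ Set.Ioo (-(Real.pi / 2)) (Real.pi / 2)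

/-- The line of sight as a function of the two angles. -/
def lineOfSight (α δ : ℝ) : Fin 3 → ℝ :=
  ![Real.cos δ * Real.cos α, Real.cos δ * Real.sin α, Real.sin δ]

namespace Attributable

/-- The line of sight unit vector `e^ρ`. -/
def eRho (A : Attributable) : Fin 3 → ℝ := lineOfSight A.α A.δ

/-- The unit vector `e^α = (cos δ)⁻¹ ∂e^ρ/∂α`. -/
def eAlpha (A : Attributable) : Fin 3 → ℝ :=
  ![-Real.sin A.α, Real.cos A.α, 0]

/-- The unit vector `e^δ = ∂e^ρ/∂δ`. -/
def eDelta (A : Attributable) : Fin 3 → ℝ :=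
  ![-(Real.sin A.δ * Real.cos A.α), -(Real.sin A.δ * Real.sin A.α), Real.cos A.δ]

theorem hasDerivAt_alpha (A : Attributable) :
    HasDerivAt (fun a => lineOfSight a A.δ) (Real.cos A.δ • A.eAlpha) A.α := by
  rw [hasDerivAt_pi]
  intro i
  fin_cases i
  · simpa [lineOfSight, eAlpha] using (Real.hasDerivAt_cos A.α).const_mul (Real.cos A.δ)
  · simpa [lineOfSight, eAlpha] using (Real.hasDerivAt_sin A.α).const_mul (Real.cos A.δ)
  · simpa [lineOfSight, eAlpha] using hasDerivAt_const A.α (Real.sin A.δ)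

theorem hasDerivAt_delta (A : Attributable) :
    HasDerivAt (fun d => lineOfSight A.α d) A.eDelta A.δ := by
  rw [hasDerivAt_pi]
  intro i
  fin_cases i
  · simpa [lineOfSight, eDelta] using (Real.hasDerivAt_cos A.δ).mul_const (Real.cos A.α)
  · simpa [lineOfSight, eDelta] using (Real.hasDerivAt_cos A.δ).mul_const (Real.sin A.α)
  · simpa [lineOfSight, eDelta] using Real.hasDerivAt_sin A.δ

/-- The vector `e^⊥ = α̇ cos δ e^α + δ̇ e^δ`. -/
def ePerp (A : Attributable) : Fin 3 → ℝ :=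
  (A.αdot * Real.cos A.δ) • A.eAlpha + A.δdot • A.eDelta

end Attributable

/-- The data of the linkage problem: for the epochs `j = 0, 1` (the first and the second one), an
attributable and the position and velocity of the observer. -/
structure Data where
  att : Fin 2 → Attributable
  pos : Fin 2 → Fin 3 → ℝ
  vel : Fin 2 → Fin 3 → ℝ

namespace Data

variable (d : Data)

/-- The line of sight at epoch `j`. -/
def e (j : Fin 2) : Fin 3 → ℝ := (d.att j).eRho

/-- The vector `e^⊥` at epoch `j`. -/
def ePerp (j : Fin 2) : Fin 3 → ℝ := (d.att j).ePerp

/-- `D = q × e^ρ`. -/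
def D (j : Fin 2) : Fin 3 → ℝ := d.pos j ⨯₃ d.e j

/-- `E = e^ρ × e^⊥`. -/
def E (j : Fin 2) : Fin 3 → ℝ := d.e j ⨯₃ d.ePerp j

/-- `F = q × e^⊥ + e^ρ × q̇`. -/
def F (j : Fin 2) : Fin 3 → ℝ := d.pos j ⨯₃ d.ePerp j + d.e j ⨯₃ d.vel j

/-- `G = q × q̇`. -/
def G (j : Fin 2) : Fin 3 → ℝ := d.pos j ⨯₃ d.vel j

/-- `D₁ × D₂`. -/
def DD : Fin 3 → ℝ := d.D 0 ⨯₃ d.D 1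

/-- The components of the vectors `e^ρ_j, e^⊥_j, q_j, q̇_j`, as one family of 24 numbers. -/
def coords : Fin 2 × Fin 4 × Fin 3 → ℝ :=
  fun x => (![d.e x.1, d.ePerp x.1, d.pos x.1, d.vel x.1] : Fin 4 → Fin 3 → ℝ) x.2.1 x.2.2

/-! The polynomial expressions in the unknowns `ρ₁, ρ₂` are defined for values of the unknowns in an
arbitrary commutative `ℝ`-algebra `R`. With `R = ℂ` this evaluates them at complex points, with
`R = ℝ[ρ₂][ρ₁]` and the two indeterminates as unknowns it gives the polynomials themselves. -/

variable {R : Type*} [CommRing R] [Algebra ℝ R]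

/-- A real vector seen in `R³`. -/
def toVec (R : Type*) [CommRing R] [Algebra ℝ R] (v : Fin 3 → ℝ) : Fin 3 → R :=
  fun i => algebraMap ℝ R (v i)

/-- The part `E ρ² + F ρ + G` of the angular momentum `D ρ̇ + E ρ² + F ρ + G`. -/
def angQuad (j : Fin 2) (ρ : R) : Fin 3 → R :=
  ρ ^ 2 • toVec R (d.E j) + ρ • toVec R (d.F j) + toVec R (d.G j)

/-- `J(ρ₁, ρ₂)`: conservation of the angular momentum reads `D₁ ρ̇₁ - D₂ ρ̇₂ = J(ρ₁, ρ₂)`. -/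
def J (ρ₁ ρ₂ : R) : Fin 3 → R := d.angQuad 1 ρ₂ - d.angQuad 0 ρ₁

/-- The conic `q = J · D₁ × D₂`. -/
def q (ρ₁ ρ₂ : R) : R := d.J ρ₁ ρ₂ ⬝ᵥ toVec R d.DD

/-- The radial velocities, from the projections of `D₁ ρ̇₁ - D₂ ρ̇₂ = J` onto `D₂ × (D₁ × D₂)` (for
`ρ̇₁`) and onto `D₁ × (D₁ × D₂)` (for `ρ̇₂`); note that
`D₁ · D₂ × (D₁ × D₂) = - D₂ · D₁ × (D₁ × D₂) = |D₁ × D₂|²`. -/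
def ρdot (j : Fin 2) (ρ₁ ρ₂ : R) : R :=
  (d.DD ⬝ᵥ d.DD)⁻¹ • (d.J ρ₁ ρ₂ ⬝ᵥ toVec R ((![d.D 1, d.D 0] : Fin 2 → Fin 3 → ℝ) j ⨯₃ d.DD))

/-- The position `r = q + ρ e^ρ` at epoch `j`. -/
def r (j : Fin 2) (ρ₁ ρ₂ : R) : Fin 3 → R :=
  toVec R (d.pos j) + (![ρ₁, ρ₂] : Fin 2 → R) j • toVec R (d.e j)

/-- The velocity `ṙ = q̇ + ρ̇ e^ρ + ρ e^⊥` at epoch `j`, with `ρ̇` eliminated. -/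
def rdot (j : Fin 2) (ρ₁ ρ₂ : R) : Fin 3 → R :=
  toVec R (d.vel j) + d.ρdot j ρ₁ ρ₂ • toVec R (d.e j)
    + (![ρ₁, ρ₂] : Fin 2 → R) j • toVec R (d.ePerp j)

/-- `K = ½ |ṙ|² r - (ṙ · r) ṙ`, where `|ṙ|² = ṙ · ṙ` and the dot product is bilinear. -/
def K (j : Fin 2) (ρ₁ ρ₂ : R) : Fin 3 → R :=
  (1 / 2 : ℝ) • ((d.rdot j ρ₁ ρ₂ ⬝ᵥ d.rdot j ρ₁ ρ₂) • d.r j ρ₁ ρ₂)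
    - (d.rdot j ρ₁ ρ₂ ⬝ᵥ d.r j ρ₁ ρ₂) • d.rdot j ρ₁ ρ₂

/-- `ξ = (K₁ - K₂) × (r₁ - r₂)`. -/
def ξ (ρ₁ ρ₂ : R) : Fin 3 → R :=
  (d.K 0 ρ₁ ρ₂ - d.K 1 ρ₁ ρ₂) ⨯₃ (d.r 0 ρ₁ ρ₂ - d.r 1 ρ₁ ρ₂)

/-- `p_j = ξ · e^ρ_j`. -/
def p (j : Fin 2) (ρ₁ ρ₂ : R) : R := d.ξ ρ₁ ρ₂ ⬝ᵥ toVec R (d.e j)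

/-- The solutions in `ℂ²` of the system `q = 0`, `ξ = 0`. -/
def solutions : Set (ℂ × ℂ) := {x | d.q x.1 x.2 = 0 ∧ d.ξ x.1 x.2 = 0}

/-- `q` as a polynomial in `ρ₁` with coefficients in `ℝ[ρ₂]`. -/
def qPoly : Polynomial (Polynomial ℝ) := d.q Polynomial.X (Polynomial.C Polynomial.X)

/-- `p_j` as a polynomial in `ρ₁` with coefficients in `ℝ[ρ₂]`. -/
def pPoly (j : Fin 2) : Polynomial (Polynomial ℝ) :=
  d.p j Polynomial.X (Polynomial.C Polynomial.X)

/-- `𝔲_j = res(p_j, q, ρ₁)`, a polynomial in `ρ₂`. -/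
def u (j : Fin 2) : Polynomial ℝ := Polynomial.resultant (d.pPoly j) d.qPoly

end Data

/-- `P` holds for generic data: it holds whenever a certain polynomial in the components of the
vectors `e^ρ_j, e^⊥_j, q_j, q̇_j`, not identically zero on the data, does not vanish. -/
def Generically (P : Data → Prop) : Prop :=
  ∃ Ψ : MvPolynomial (Fin 2 × Fin 4 × Fin 3) ℝ,
    (∃ d : Data, MvPolynomial.eval d.coords Ψ ≠ 0) ∧
    ∀ d : Data, MvPolynomial.eval d.coords Ψ ≠ 0 → P d

end Linkage

end

/-! Write `ℓ_j` for `losMomentum` and `m_j` for `crossTerm`, both of degree one in `ρ_j` alone. On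
the conic `q = 0` the two angular momenta agree; call the common value `c`. Since `K_j` and `r_j`
are orthogonal to `c`, the vector `ξ` is parallel to `c`, so `p₁ (c · e₂) = p₂ (c · e₁)`, and `c ·
e_j = ℓ_j`. Thus `p₁ ℓ₂ ≡ p₂ ℓ₁` modulo `q` (`p_mul_losMomentum`, `qPoly_dvd`). Moreover `q = -(ℓ₁
m₁ + ℓ₂ m₂)` (`q_eq`), so eliminating `ρ₁` from `ℓ₁` and `q` gives a constant times `ℓ₂ m₂`.
Multiplicativity of the resultant then yields `ℓ₂ 𝔲₁ = const · m₂ 𝔲₂` (`losMomentum_mul_elim`). If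
`ℓ₂` and `m₂` are coprime, `𝔲₁` and `𝔲₂` are constant multiples of `m₂ w` and `ℓ₂ w`, and `w` is
their greatest common divisor.

The degrees come from Bézout's bound: `p_j` has total degree at most 5, one less than the obvious
count, and `q` at most 2, so the eliminants have degree at most 10 and `w` at most 9, with equality
generically.

If `w(ρ₂) = 0`, then `p₂` and `q` have a common zero above `ρ₂`; separability gives `ℓ₂(ρ₂) ≠ 0`,
hence `p₁ = 0` there as well, and `p₁ = p₂ = 0` forces `ξ = 0` (`ξ_eq_zero_iff`). Two solutions
above the same `ρ₂` would make it a double root of an eliminant. So the solutions correspond to the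
nine simple roots of `w`.

All this needs only that certain rational functions of the data, with powers of `|D₁ × D₂|²` as
denominators, do not vanish (`IsNondegenerate`). That they are not identically zero is shown by one
explicit example, `sample`. -/

namespace Linkage

open Polynomial

/-! ### Resultants with prescribed nominal degrees -/

section Resultant

variable {R : Type*} [CommRing R]

/-- Raising the nominal degree of the left argument by one contributes a signed factor `g.coeff n`;
these factors multiply consistently, which reduces the claim to actual degrees. -/
theorem resultant_mul_left_of_le {f₁ f₂ g : R[X]} {m₁ m₂ n : ℕ} (h₁ : f₁.natDegree ≤ m₁)
    (h₂ : f₂.natDegree ≤ m₂) (hg : g.natDegree ≤ n) :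
    resultant (f₁ * f₂) g (m₁ + m₂) n = resultant f₁ g m₁ n * resultant f₂ g m₂ n := by
  obtain ⟨k₁, rfl⟩ := le_iff_exists_add.mp h₁
  obtain ⟨k₂, rfl⟩ := le_iff_exists_add.mp h₂
  rw [show f₁.natDegree + k₁ + (f₂.natDegree + k₂) = f₁.natDegree + f₂.natDegree + (k₁ + k₂) by ring,
    resultant_add_left_deg _ _ _ _ _ natDegree_mul_le, resultant_mul_left _ _ _ _ hg,
    resultant_add_left_deg _ _ _ _ _ le_rfl, resultant_add_left_deg _ _ _ _ _ le_rfl]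
  ring

theorem resultant_linear_left (g : R[X]) (a b : R) :
    resultant (C a * X + C b) g 1 2 = g.coeff 2 * b ^ 2 - g.coeff 1 * a * b + g.coeff 0 * a ^ 2 := by
  have : (sylvester (C a * X + C b) g 1 2) =
      !![g.coeff 0, b, 0; g.coeff 1, a, b; g.coeff 2, 0, a] := by
    ext i j
    fin_cases i <;> fin_cases j <;>
      simp [sylvester, Fin.addCases, coeff_X, coeff_C, Fin.castLT, Fin.subNat]
  rw [resultant, this, Matrix.det_fin_three]
  simp
  ring

/-- The resultant with a polynomial of degree two depends only on the remainder modulo it. -/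
theorem resultant_of_eq_linear_add_mul {p g h : R[X]} {a b : R} {k : ℕ} (hg : g.natDegree ≤ 2)
    (hh : h.natDegree + 2 ≤ 1 + k) (hp : p = C a * X + C b + g * h) :
    resultant p g (1 + k) 2 =
      g.coeff 2 ^ k * (g.coeff 2 * b ^ 2 - g.coeff 1 * a * b + g.coeff 0 * a ^ 2) := by
  rw [hp, resultant_add_mul_left _ _ _ _ _ hh hg,
    resultant_add_left_deg _ _ _ _ _ natDegree_linear_le, resultant_linear_left]
  simp

end Resultant

/-! ### Total degree and Bézout's bound -/

section TotalDegree

variable {R : Type*} [CommRing R]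

/-- Bivariate polynomials of total degree at most `n`. -/
def totalDegreeLE (R : Type*) [CommRing R] (n : ℕ) : AddSubgroup R[X][X] where
  carrier := {p | ∀ i j, n < i + j → (p.coeff i).coeff j = 0}
  zero_mem' := by simp
  add_mem' := by
    intro p q hp hq i j h
    simp [hp i j h, hq i j h]
  neg_mem' := by
    intro p hp i j h
    simp [hp i j h]

theorem mul_mem_totalDegreeLE {m n k : ℕ} {p q : R[X][X]} (hp : p ∈ totalDegreeLE R m)
    (hq : q ∈ totalDegreeLE R n) (hk : m + n ≤ k) : p * q ∈ totalDegreeLE R k := by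
  intro i j h
  rw [coeff_mul, finsetSum_coeff]
  refine Finset.sum_eq_zero fun x hx => ?_
  rw [coeff_mul]
  refine Finset.sum_eq_zero fun y hy => ?_
  rw [Finset.HasAntidiagonal.mem_antidiagonal] at hx hy
  by_cases h' : m < x.1 + y.1
  · rw [hp _ _ h', zero_mul]
  · rw [hq x.2 y.2 (by lia), mul_zero]

theorem natDegree_le_of_mem_totalDegreeLE {n : ℕ} {p : R[X][X]} (hp : p ∈ totalDegreeLE R n) :
    p.natDegree ≤ n := by
  refine natDegree_le_iff_coeff_eq_zero.2 fun i hi => ?_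
  ext j
  exact hp i j (by lia)

theorem natDegree_coeff_of_mem_totalDegreeLE {n i : ℕ} {p : R[X][X]} (hp : p ∈ totalDegreeLE R n)
    (hi : i ≤ n) : (p.coeff i).natDegree + i ≤ n := by
  have : (p.coeff i).natDegree ≤ n - i :=
    natDegree_le_iff_coeff_eq_zero.2 fun j hj => hp i j (by lia)
  lia

/-- Every nonzero term of the Leibniz expansion picks each row and each column once, so the weights
add up to the same bound for all permutations. -/
theorem natDegree_det_le {ι : Type*} [Fintype ι] [DecidableEq ι] (M : Matrix ι ι R[X]) (a c : ι → ℕ)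
    (h : ∀ i j, M i j ≠ 0 → (M i j).natDegree + a i ≤ c j) :
    M.det.natDegree ≤ ∑ i, c i - ∑ i, a i := by
  rw [Matrix.det_apply]
  refine natDegree_sum_le_of_forall_le _ _ fun σ _ => ?_
  refine (natDegree_smul_le _ _).trans ?_
  by_cases h0 : ∃ i, M (σ i) i = 0
  · obtain ⟨i, hi⟩ := h0
    rw [Finset.prod_eq_zero (f := fun i => M (σ i) i) (Finset.mem_univ i) hi]
    simp
  · push Not at h0
    refine (natDegree_prod_le _ _).trans ?_
    rw [Nat.le_sub_iff_add_le, ← Equiv.sum_comp σ a, ← Finset.sum_add_distrib]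
    · exact Finset.sum_le_sum fun i _ => h _ _ (h0 i)
    · rw [← Equiv.sum_comp σ a]
      exact Finset.sum_le_sum fun i _ => (Nat.le_add_left _ _).trans (h _ _ (h0 i))

/-- Elimination of a variable from polynomials of total degrees `m` and `n`. -/
theorem natDegree_resultant_le {m n : ℕ} {p q : R[X][X]} (hp : p ∈ totalDegreeLE R m)
    (hq : q ∈ totalDegreeLE R n) : (resultant p q m n).natDegree ≤ m * n := by
  -- Row `i` has weight `i`; a column has weight total degree plus shift. The two weight sums differ
  -- by exactly `m * n`.
  refine (natDegree_det_le (sylvester p q m n) (fun i => (i : ℕ))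
    (fun j => Fin.addCases (fun i => n + (i : ℕ)) (fun i => m + (i : ℕ)) j) ?_).trans ?_
  · intro i j
    induction j using Fin.addCases with
    | left j =>
      simp only [sylvester, Matrix.of_apply, Fin.addCases_left]
      split_ifs with hij
      · intro _
        have := natDegree_coeff_of_mem_totalDegreeLE hq (i := i - j) (by simp at hij; lia)
        simp at hij
        lia
      · simp
    | right j =>
      simp only [sylvester, Matrix.of_apply, Fin.addCases_right]
      split_ifs with hij
      · intro _
        have := natDegree_coeff_of_mem_totalDegreeLE hp (i := i - j) (by simp at hij; lia)
        simp at hij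
        lia
      · simp
  · rw [Fin.sum_univ_add, Fin.sum_univ_add]
    simp only [Fin.addCases_left, Fin.addCases_right, Fin.val_castAdd, Fin.val_natAdd,
      Finset.sum_add_distrib, Finset.sum_const, Finset.card_univ, Fintype.card_fin, smul_eq_mul]
    have : n * m = m * n := mul_comm _ _
    lia

end TotalDegree

/-! ### Polynomials whose coefficients are functions of a parameter -/

section Families

variable {ι R : Type*} [CommRing R]

/-- Families of polynomials all of whose coefficients belong to a given ring of functions. -/
def polyFamily (S : Subring (ι → R)) : Subring (ι → R[X]) where
  carrier := {F | ∀ n, (fun i => (F i).coeff n) ∈ S}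
  mul_mem' := by
    intro F G hF hG n
    have : (fun i => ((F * G) i).coeff n) = ∑ x ∈ Finset.HasAntidiagonal.antidiagonal n,
        (fun i => (F i).coeff x.1) * (fun i => (G i).coeff x.2) := by
      ext i
      simp [coeff_mul]
    rw [this]
    exact S.sum_mem fun x _ => S.mul_mem (hF _) (hG _)
  one_mem' := by
    intro n
    by_cases h : n = 0
    · have : (fun i => ((1 : ι → R[X]) i).coeff n) = 1 := by ext i; simp [h]
      rw [this]; exact S.one_mem
    · have : (fun i => ((1 : ι → R[X]) i).coeff n) = 0 := by ext i; simp [coeff_one, h]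
      rw [this]; exact S.zero_mem
  add_mem' := by
    intro F G hF hG n
    have : (fun i => ((F + G) i).coeff n) = (fun i => (F i).coeff n) + fun i => (G i).coeff n := by
      ext i; simp
    rw [this]
    exact S.add_mem (hF n) (hG n)
  zero_mem' := by
    intro n
    have : (fun i => ((0 : ι → R[X]) i).coeff n) = 0 := by ext i; simp
    rw [this]; exact S.zero_mem
  neg_mem' := by
    intro F hF n
    have : (fun i => ((-F) i).coeff n) = -(fun i => (F i).coeff n) := by ext i; simp
    rw [this]; exact S.neg_mem (hF n)

theorem const_C_mem_polyFamily {S : Subring (ι → R)} {f : ι → R} (hf : f ∈ S) :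
    (fun i => C (f i)) ∈ polyFamily S := by
  intro n
  by_cases h : n = 0
  · simpa [h] using hf
  · simp only [coeff_C, h, if_false]
    exact S.zero_mem

theorem const_X_mem_polyFamily (S : Subring (ι → R)) : (fun _ => X) ∈ polyFamily S := by
  intro n
  by_cases h : 1 = n
  · simp only [coeff_X, h, if_true]
    exact S.one_mem
  · simp only [coeff_X, h, if_false]
    exact S.zero_mem

theorem derivative_mem_polyFamily {S : Subring (ι → R)} {F : ι → R[X]} (hF : F ∈ polyFamily S) :
    (fun i => derivative (F i)) ∈ polyFamily S := by
  intro n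
  have : (fun i => (derivative (F i)).coeff n) = (n + 1) • fun i => (F i).coeff (n + 1) := by
    ext i
    simp [coeff_derivative, mul_comm]
  rw [this]
  exact S.nsmul_mem (hF _) _

theorem det_mem {κ : Type*} [Fintype κ] [DecidableEq κ] {S : Subring (ι → R)}
    {M : ι → Matrix κ κ R} (hM : ∀ a b, (fun i => M i a b) ∈ S) : (fun i => (M i).det) ∈ S := by
  have : (fun i => (M i).det) = ∑ σ : Equiv.Perm κ, ((Equiv.Perm.sign σ : ℤˣ) : ℤ) •
      ∏ a, fun i => M i (σ a) a := by
    ext i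
    simp [Matrix.det_apply, Units.smul_def]
  rw [this]
  exact S.sum_mem fun σ _ => S.zsmul_mem (S.prod_mem fun a _ => hM _ _) _

theorem resultant_mem {S : Subring (ι → R)} {F G : ι → R[X]} (hF : F ∈ polyFamily S)
    (hG : G ∈ polyFamily S) (m n : ℕ) : (fun i => resultant (F i) (G i) m n) ∈ S := by
  refine det_mem fun a b => ?_
  induction b using Fin.addCases with
  | left j =>
    simp only [sylvester, Matrix.of_apply, Fin.addCases_left]
    split_ifs
    · exact hG _
    · exact S.zero_mem
  | right j =>
    simp only [sylvester, Matrix.of_apply, Fin.addCases_right]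
    split_ifs
    · exact hF _
    · exact S.zero_mem

end Families

/-! ### Vector identities in dimension three -/

section Vectors

variable {R : Type*} [CommRing R]

theorem dot_three (v w : Fin 3 → R) : v ⬝ᵥ w = v 0 * w 0 + v 1 * w 1 + v 2 * w 2 := by
  simp [dotProduct, Fin.sum_univ_three]

theorem vec_three_ext {α : Type*} {v w : Fin 3 → α} (h₀ : v 0 = w 0)
    (h₁ : v 1 = w 1) (h₂ : v 2 = w 2) : v = w := by
  ext i
  fin_cases i <;> assumption

theorem cross_zero (v w : Fin 3 → R) : (v ⨯₃ w) 0 = v 1 * w 2 - v 2 * w 1 := by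
  simp [cross_apply]

theorem cross_one (v w : Fin 3 → R) : (v ⨯₃ w) 1 = v 2 * w 0 - v 0 * w 2 := by
  simp [cross_apply]

theorem cross_two (v w : Fin 3 → R) : (v ⨯₃ w) 2 = v 0 * w 1 - v 1 * w 0 := by
  simp [cross_apply]

/-- Expansion of a vector in terms of `x`, `y` and `x × y`. -/
theorem smul_sub_smul_cross (x y v : Fin 3 → R) :
    (v ⬝ᵥ (y ⨯₃ (x ⨯₃ y))) • x - (v ⬝ᵥ (x ⨯₃ (x ⨯₃ y))) • y =
      ((x ⨯₃ y) ⬝ᵥ (x ⨯₃ y)) • v - (v ⬝ᵥ (x ⨯₃ y)) • (x ⨯₃ y) := by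
  apply vec_three_ext <;>
    simp only [Pi.sub_apply, Pi.smul_apply, smul_eq_mul, dot_three, cross_zero, cross_one,
      cross_two] <;> ring

/-- A cross product of two vectors orthogonal to `c` is parallel to `c`. -/
theorem cross_dot_mul_comm {k w c : Fin 3 → R} (hk : c ⬝ᵥ k = 0) (hw : c ⬝ᵥ w = 0)
    (x y : Fin 3 → R) :
    ((k ⨯₃ w) ⬝ᵥ x) * (c ⬝ᵥ y) = ((k ⨯₃ w) ⬝ᵥ y) * (c ⬝ᵥ x) := by
  simp only [dot_three, cross_zero, cross_one, cross_two] at *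
  linear_combination (w 0 * (x 1 * y 2 - x 2 * y 1) + w 1 * (x 2 * y 0 - x 0 * y 2)
    + w 2 * (x 0 * y 1 - x 1 * y 0)) * hk - (k 0 * (x 1 * y 2 - x 2 * y 1)
    + k 1 * (x 2 * y 0 - x 0 * y 2) + k 2 * (x 0 * y 1 - x 1 * y 0)) * hw

theorem cross_dot_combination (x y : Fin 3 → R) (s t : R) :
    (x ⨯₃ y) ⬝ᵥ (s • x - t • y) = 0 := by
  simp only [Pi.sub_apply, Pi.smul_apply, smul_eq_mul, dot_three, cross_zero, cross_one, cross_two]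
  ring

/-- A vector orthogonal to three linearly independent ones vanishes. -/
theorem eq_zero_of_dot_eq_zero {K : Type*} [Field K] {v x y z : Fin 3 → K}
    (hx : v ⬝ᵥ x = 0) (hy : v ⬝ᵥ y = 0) (hz : v ⬝ᵥ z = 0) (h : z ⬝ᵥ (x ⨯₃ y) ≠ 0) : v = 0 := by
  simp only [dot_three, cross_zero, cross_one, cross_two] at *
  apply vec_three_ext <;> refine (mul_eq_zero.1 ?_).resolve_left h
  · linear_combination (y 1 * z 2 - y 2 * z 1) * hx + (z 1 * x 2 - z 2 * x 1) * hy
      + (x 1 * y 2 - x 2 * y 1) * hz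
  · linear_combination (y 2 * z 0 - y 0 * z 2) * hx + (z 2 * x 0 - z 0 * x 2) * hy
      + (x 2 * y 0 - x 0 * y 2) * hz
  · linear_combination (y 0 * z 1 - y 1 * z 0) * hx + (z 0 * x 1 - z 1 * x 0) * hy
      + (x 0 * y 1 - x 1 * y 0) * hz

/-- The component along `e` of `(K₁ - K₂) × (r₁ - r₂)`, where `r₁` and `ṙ₁` enter only through
their components orthogonal to `e`. -/
theorem cross_dot_expand (P Q e e' v v' : Fin 3 → R) (x x' y y' s s' t t' : R) :
    ((s • (P + x • e) - t • (v + y • e)) - (s' • (Q + x' • e') - t' • (v' + y' • e'))) ⨯₃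
        ((P + x • e) - (Q + x' • e')) ⬝ᵥ e =
      s * (P ⬝ᵥ ((P - (Q + x' • e')) ⨯₃ e)) - t * (v ⬝ᵥ ((P - (Q + x' • e')) ⨯₃ e))
        - s' * ((Q + x' • e') ⬝ᵥ (P ⨯₃ e)) + t' * (v' ⬝ᵥ ((P - (Q + x' • e')) ⨯₃ e))
        + t' * y' * (e' ⬝ᵥ ((P - Q) ⨯₃ e)) := by
  simp only [Pi.sub_apply, Pi.add_apply, Pi.smul_apply, smul_eq_mul, dot_three, cross_zero,
    cross_one, cross_two]
  ring

end Vectors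

/-! ### Angular momentum and the direction of `ξ` -/

namespace Data

variable (d : Data) {R R' : Type*} [CommRing R] [Algebra ℝ R] [CommRing R'] [Algebra ℝ R']

section Naturality

variable (φ : R →ₐ[ℝ] R')

/-- Compatibility with algebra homomorphisms serves both to evaluate the polynomials at points and
to pass to the quotient by `qPoly`. -/
theorem map_toVec (v : Fin 3 → ℝ) (i : Fin 3) : φ (toVec R v i) = toVec R' v i := by
  simp [toVec]

theorem map_J (ρ₁ ρ₂ : R) (i : Fin 3) : φ (d.J ρ₁ ρ₂ i) = d.J (φ ρ₁) (φ ρ₂) i := by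
  simp [J, angQuad, map_toVec]

theorem map_q (ρ₁ ρ₂ : R) : φ (d.q ρ₁ ρ₂) = d.q (φ ρ₁) (φ ρ₂) := by
  simp [q, dot_three, map_J, map_toVec]

theorem map_ρdot (j : Fin 2) (ρ₁ ρ₂ : R) : φ (d.ρdot j ρ₁ ρ₂) = d.ρdot j (φ ρ₁) (φ ρ₂) := by
  simp only [ρdot, map_smul, dot_three, map_J, map_toVec, map_add, map_mul]

theorem map_unknown (j : Fin 2) (ρ₁ ρ₂ : R) :
    φ ((![ρ₁, ρ₂] : Fin 2 → R) j) = (![φ ρ₁, φ ρ₂] : Fin 2 → R') j := by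
  fin_cases j <;> simp

theorem map_r (j : Fin 2) (ρ₁ ρ₂ : R) (i : Fin 3) :
    φ (d.r j ρ₁ ρ₂ i) = d.r j (φ ρ₁) (φ ρ₂) i := by
  simp [r, map_toVec, map_unknown]

theorem map_rdot (j : Fin 2) (ρ₁ ρ₂ : R) (i : Fin 3) :
    φ (d.rdot j ρ₁ ρ₂ i) = d.rdot j (φ ρ₁) (φ ρ₂) i := by
  simp [rdot, map_toVec, map_unknown, map_ρdot]

theorem map_K (j : Fin 2) (ρ₁ ρ₂ : R) (i : Fin 3) :
    φ (d.K j ρ₁ ρ₂ i) = d.K j (φ ρ₁) (φ ρ₂) i := by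
  simp only [K, Pi.sub_apply, Pi.smul_apply, map_sub, map_smul, smul_eq_mul, map_mul, dot_three,
    map_add, map_r, map_rdot]

theorem map_p (j : Fin 2) (ρ₁ ρ₂ : R) : φ (d.p j ρ₁ ρ₂) = d.p j (φ ρ₁) (φ ρ₂) := by
  simp only [p, ξ, dot_three, cross_zero, cross_one, cross_two, Pi.sub_apply]
  simp only [map_add, map_sub, map_mul, map_toVec, map_r, map_K]

end Naturality

/-- The projection `c · e^ρ` of the angular momentum on the line of sight, which is a polynomial of
degree one in `ρ`. -/
noncomputable def losMomentum (j : Fin 2) (ρ : R) : R :=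
  algebraMap ℝ R (d.e j ⬝ᵥ d.pos j ⨯₃ d.ePerp j) * ρ + algebraMap ℝ R (d.e j ⬝ᵥ d.G j)

/-- The product `r_j · D_i` for `i ≠ j`, a polynomial of degree one in `ρ_j`. -/
noncomputable def crossTerm (j : Fin 2) (ρ : R) : R :=
  algebraMap ℝ R (d.e j ⬝ᵥ d.D (1 - j)) * ρ + algebraMap ℝ R (d.pos j ⬝ᵥ d.D (1 - j))

/-- With `c_j = r_j × ṙ_j`, one has `D₁ × D₂ = (r₁ × e₁) × D₂ = (r₁ · D₂) e₁ - (e₁ · D₂) r₁`, and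
`c₁` is orthogonal to `r₁`. So `c₁ · D₁ × D₂` is the product of `c₁ · e₁` and `r₁ · D₂`; for `c₂`
the same holds with opposite sign. -/
theorem q_eq (ρ₁ ρ₂ : R) :
    d.q ρ₁ ρ₂ = -(d.losMomentum 0 ρ₁ * d.crossTerm 0 ρ₁ + d.losMomentum 1 ρ₂ * d.crossTerm 1 ρ₂) := by
  simp only [q, J, angQuad, losMomentum, crossTerm, DD, D, E, F, G, toVec, dot_three, cross_zero,
    cross_one, cross_two, Pi.add_apply, Pi.sub_apply, Pi.smul_apply, smul_eq_mul, map_add, map_sub,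
    map_mul, sub_zero, sub_self]
  ring

theorem toVec_cross (v w : Fin 3 → ℝ) : toVec R (v ⨯₃ w) = toVec R v ⨯₃ toVec R w := by
  apply vec_three_ext <;> simp [toVec, cross_zero, cross_one, cross_two]

theorem toVec_dot (v w : Fin 3 → ℝ) : toVec R v ⬝ᵥ toVec R w = algebraMap ℝ R (v ⬝ᵥ w) := by
  simp [toVec, dot_three]

theorem r_cross_rdot_zero (ρ₁ ρ₂ : R) :
    d.r 0 ρ₁ ρ₂ ⨯₃ d.rdot 0 ρ₁ ρ₂ = d.ρdot 0 ρ₁ ρ₂ • toVec R (d.D 0) + d.angQuad 0 ρ₁ := by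
  apply vec_three_ext <;>
    simp only [r, rdot, angQuad, D, E, F, G, toVec, cross_zero, cross_one, cross_two, Pi.add_apply,
      Pi.smul_apply, smul_eq_mul, Matrix.cons_val_zero] <;>
    simp only [map_add, map_sub, map_mul] <;> ring

theorem r_cross_rdot_one (ρ₁ ρ₂ : R) :
    d.r 1 ρ₁ ρ₂ ⨯₃ d.rdot 1 ρ₁ ρ₂ = d.ρdot 1 ρ₁ ρ₂ • toVec R (d.D 1) + d.angQuad 1 ρ₂ := by
  apply vec_three_ext <;>
    simp only [r, rdot, angQuad, D, E, F, G, toVec, cross_zero, cross_one, cross_two, Pi.add_apply,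
      Pi.smul_apply, smul_eq_mul, Matrix.cons_val_one, Matrix.cons_val_zero] <;>
    simp only [map_add, map_sub, map_mul] <;> ring

/-- On the conic `q = 0` the angular momentum is conserved. -/
theorem angularMomentum_eq (hN : d.DD ⬝ᵥ d.DD ≠ 0) {ρ₁ ρ₂ : R} (hq : d.q ρ₁ ρ₂ = 0) :
    d.r 0 ρ₁ ρ₂ ⨯₃ d.rdot 0 ρ₁ ρ₂ = d.r 1 ρ₁ ρ₂ ⨯₃ d.rdot 1 ρ₁ ρ₂ := by
  -- When `q = 0`, `J` has no component along `D₁ × D₂`, so the two projections defining `ρ̇₁, ρ̇₂`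
  -- solve the full vector equation.
  have key := smul_sub_smul_cross (toVec R (d.D 0)) (toVec R (d.D 1)) (d.J ρ₁ ρ₂)
  rw [← toVec_cross, ← DD, ← toVec_cross, ← toVec_cross, toVec_dot] at key
  have hq' : d.J ρ₁ ρ₂ ⬝ᵥ toVec R d.DD = 0 := hq
  rw [hq', zero_smul, sub_zero] at key
  have h1 : d.ρdot 0 ρ₁ ρ₂ • toVec R (d.D 0) - d.ρdot 1 ρ₁ ρ₂ • toVec R (d.D 1) = d.J ρ₁ ρ₂ := by
    have := congrArg (fun v => (d.DD ⬝ᵥ d.DD)⁻¹ • v) key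
    simp only [smul_sub, ← smul_assoc, algebraMap_smul] at this
    rw [smul_eq_mul, inv_mul_cancel₀ hN, one_smul] at this
    simpa [ρdot] using this
  rw [r_cross_rdot_zero, r_cross_rdot_one]
  rw [J] at h1
  linear_combination (exp := 1) h1

theorem losMomentum_zero (ρ₁ ρ₂ : R) :
    (d.r 0 ρ₁ ρ₂ ⨯₃ d.rdot 0 ρ₁ ρ₂) ⬝ᵥ toVec R (d.e 0) = d.losMomentum 0 ρ₁ := by
  simp only [r, rdot, losMomentum, G, toVec, dot_three, cross_zero, cross_one, cross_two,
    Pi.add_apply, Pi.smul_apply, smul_eq_mul, Matrix.cons_val_zero]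
  simp only [map_add, map_sub, map_mul]
  ring

theorem losMomentum_one (ρ₁ ρ₂ : R) :
    (d.r 1 ρ₁ ρ₂ ⨯₃ d.rdot 1 ρ₁ ρ₂) ⬝ᵥ toVec R (d.e 1) = d.losMomentum 1 ρ₂ := by
  simp only [r, rdot, losMomentum, G, toVec, dot_three, cross_zero, cross_one, cross_two,
    Pi.add_apply, Pi.smul_apply, smul_eq_mul, Matrix.cons_val_one, Matrix.cons_val_zero]
  simp only [map_add, map_sub, map_mul]
  ring

theorem momentum_dot_K (j : Fin 2) (ρ₁ ρ₂ : R) :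
    (d.r j ρ₁ ρ₂ ⨯₃ d.rdot j ρ₁ ρ₂) ⬝ᵥ d.K j ρ₁ ρ₂ = 0 := by
  rw [K, ← smul_assoc, cross_dot_combination]

theorem momentum_dot_r (j : Fin 2) (ρ₁ ρ₂ : R) :
    (d.r j ρ₁ ρ₂ ⨯₃ d.rdot j ρ₁ ρ₂) ⬝ᵥ d.r j ρ₁ ρ₂ = 0 := by
  simpa using cross_dot_combination (d.r j ρ₁ ρ₂) (d.rdot j ρ₁ ρ₂) 1 0

/-- On the conic `q = 0` the vector `ξ` is parallel to the angular momentum. -/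
theorem p_mul_losMomentum (hN : d.DD ⬝ᵥ d.DD ≠ 0) {ρ₁ ρ₂ : R} (hq : d.q ρ₁ ρ₂ = 0) :
    d.p 0 ρ₁ ρ₂ * d.losMomentum 1 ρ₂ = d.p 1 ρ₁ ρ₂ * d.losMomentum 0 ρ₁ := by
  have h := d.angularMomentum_eq hN hq
  rw [← losMomentum_one d ρ₁, ← losMomentum_zero d ρ₁ ρ₂, ← h, p, p, ξ]
  apply cross_dot_mul_comm
  · rw [dotProduct_sub, momentum_dot_K, h, momentum_dot_K, sub_zero]
  · rw [dotProduct_sub, momentum_dot_r, h, momentum_dot_r, sub_zero]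

theorem ξ_dot_r_sub_r (ρ₁ ρ₂ : R) : d.ξ ρ₁ ρ₂ ⬝ᵥ (d.r 0 ρ₁ ρ₂ - d.r 1 ρ₁ ρ₂) = 0 := by
  simpa [ξ] using cross_dot_combination (d.K 0 ρ₁ ρ₂ - d.K 1 ρ₁ ρ₂) (d.r 0 ρ₁ ρ₂ - d.r 1 ρ₁ ρ₂) 0 (-1)

/-- The system `ξ = 0` is equivalent to `p₁ = p₂ = 0`. -/
theorem ξ_eq_zero_iff (hV : (d.pos 0 - d.pos 1) ⬝ᵥ (d.e 0 ⨯₃ d.e 1) ≠ 0) (ρ₁ ρ₂ : ℂ) :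
    d.ξ ρ₁ ρ₂ = 0 ↔ d.p 0 ρ₁ ρ₂ = 0 ∧ d.p 1 ρ₁ ρ₂ = 0 := by
  refine ⟨fun h => by simp [p, h], fun ⟨h0, h1⟩ => ?_⟩
  refine eq_zero_of_dot_eq_zero h0 h1 (d.ξ_dot_r_sub_r ρ₁ ρ₂) ?_
  -- The unknowns move `r_j` along `e_j` only, so this determinant does not depend on them.
  have : (d.r 0 ρ₁ ρ₂ - d.r 1 ρ₁ ρ₂) ⬝ᵥ (toVec ℂ (d.e 0) ⨯₃ toVec ℂ (d.e 1)) =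
      algebraMap ℝ ℂ ((d.pos 0 - d.pos 1) ⬝ᵥ (d.e 0 ⨯₃ d.e 1)) := by
    simp only [r, toVec, dot_three, cross_zero,
      cross_one, cross_two, Pi.add_apply, Pi.sub_apply, Pi.smul_apply, smul_eq_mul, map_add, map_sub,
      map_mul, Matrix.cons_val_one, Matrix.cons_val_zero]
    ring
  rw [this]
  exact (_root_.map_ne_zero _).2 hV

end Data

/-! ### Closure properties of total degree bounds -/

section TotalDegree

variable {R : Type*} [CommRing R]

theorem C_C_mem_totalDegreeLE (x : R) (n : ℕ) : C (C x) ∈ totalDegreeLE R n := by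
  intro i j h
  by_cases hi : i = 0
  · have hj : j ≠ 0 := by lia
    simp [hi, coeff_C, hj]
  · simp [coeff_C, hi]

theorem X_mem_totalDegreeLE : (X : R[X][X]) ∈ totalDegreeLE R 1 := by
  intro i j h
  by_cases hi : 1 = i
  · have hj : j ≠ 0 := by lia
    simp [← hi, coeff_one, hj]
  · simp [coeff_X, hi]

theorem C_X_mem_totalDegreeLE : (C X : R[X][X]) ∈ totalDegreeLE R 1 := by
  intro i j h
  by_cases hi : i = 0
  · have hj : 1 ≠ j := by lia
    simp [hi, coeff_X, hj]
  · simp [coeff_C, hi]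

theorem totalDegreeLE_mono {m n : ℕ} (h : m ≤ n) : totalDegreeLE R m ≤ totalDegreeLE R n :=
  fun _ hp i j hij => hp i j (by lia)

theorem dot_mem_totalDegreeLE {m n k : ℕ} {v w : Fin 3 → R[X][X]}
    (hv : ∀ i, v i ∈ totalDegreeLE R m) (hw : ∀ i, w i ∈ totalDegreeLE R n) (hk : m + n ≤ k) :
    v ⬝ᵥ w ∈ totalDegreeLE R k :=
  sum_mem fun i _ => mul_mem_totalDegreeLE (hv i) (hw i) hk

theorem cross_mem_totalDegreeLE {m n k : ℕ} {v w : Fin 3 → R[X][X]}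
    (hv : ∀ i, v i ∈ totalDegreeLE R m) (hw : ∀ i, w i ∈ totalDegreeLE R n) (hk : m + n ≤ k)
    (i : Fin 3) : (v ⨯₃ w) i ∈ totalDegreeLE R k := by
  fin_cases i
  · exact (cross_zero v w).symm ▸ sub_mem (mul_mem_totalDegreeLE (hv _) (hw _) hk)
      (mul_mem_totalDegreeLE (hv _) (hw _) hk)
  · exact (cross_one v w).symm ▸ sub_mem (mul_mem_totalDegreeLE (hv _) (hw _) hk)
      (mul_mem_totalDegreeLE (hv _) (hw _) hk)
  · exact (cross_two v w).symm ▸ sub_mem (mul_mem_totalDegreeLE (hv _) (hw _) hk)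
      (mul_mem_totalDegreeLE (hv _) (hw _) hk)

theorem real_smul_mem_totalDegreeLE {n : ℕ} {p : ℝ[X][X]} (c : ℝ) (hp : p ∈ totalDegreeLE ℝ n) :
    c • p ∈ totalDegreeLE ℝ n := by
  intro i j h
  simp [hp i j h]

end TotalDegree

/-- The nominal degree is padded by one so that `f * C a` can be compared with a product of `f`-like
and linear factors. -/
theorem resultant_mul_C_succ {R : Type*} [CommRing R] {f g : R[X]} {m n : ℕ}
    (hf : f.natDegree ≤ m) (hg : g.natDegree ≤ n) (a : R) :
    resultant (f * C a) g (m + 1) n = (-1) ^ n * g.coeff n * (resultant f g m n * a ^ n) := by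
  rw [resultant_succ_left_deg _ _ _ _ ((natDegree_mul_C_le f a).trans hf)]
  congr 1
  have h := resultant_mul_left_of_le hf (natDegree_C a).le hg
  rwa [resultant_C_zero_left] at h

/-- The resultant with `g` is multiplicative and blind to multiples of `g`; the factor `c` pays for
`C a` having nominal degree one instead of zero. -/
theorem resultant_mul_eq_of_eq_add_mul {p₀ p₁ l g h : ℝ[X][X]} {a b c : ℝ[X]} {m : ℕ}
    (hp₀ : p₀.natDegree ≤ m) (hp₁ : p₁.natDegree ≤ m) (hl : l.natDegree ≤ 1)
    (hg : g.natDegree ≤ 2) (hh : h.natDegree + 2 ≤ m + 1) (e : p₀ * C a = p₁ * l + g * h)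
    (hb : resultant l g 1 2 = b) (hc : g.coeff 2 = c) :
    c * (resultant p₀ g m 2 * a ^ 2) = resultant p₁ g m 2 * b := by
  have e₀ := resultant_mul_C_succ hp₀ hg a
  rw [e, resultant_add_mul_left _ _ _ _ _ hh hg, resultant_mul_left_of_le hp₁ hl hg] at e₀
  simpa [hb, hc] using e₀.symm

theorem C_mul_eq_C_mul_of_neg_mul_eq {a b : ℝ} {l m u v : ℝ[X]} (ha : a ≠ 0) (hl : l ≠ 0)
    (h : C (-(a * b)) * (u * l ^ 2) = v * -(C a ^ 2 * (l * m))) :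
    C b * (l * u) = C a * (m * v) := by
  rw [C_neg, C_mul] at h
  refine mul_left_cancel₀ (C_ne_zero.2 ha) (mul_left_cancel₀ hl ?_)
  linear_combination -h

/-! ### Degrees of the polynomials and the relation between the eliminants -/

namespace Data

variable (d : Data)

section Degrees

theorem toVec_mem_totalDegreeLE (v : Fin 3 → ℝ) (n : ℕ) (i : Fin 3) :
    toVec ℝ[X][X] v i ∈ totalDegreeLE ℝ n :=
  C_C_mem_totalDegreeLE (v i) n

theorem unknown_mem_totalDegreeLE (j : Fin 2) :
    (![X, C X] : Fin 2 → ℝ[X][X]) j ∈ totalDegreeLE ℝ 1 := by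
  fin_cases j
  · exact X_mem_totalDegreeLE
  · exact C_X_mem_totalDegreeLE

theorem angQuad_mem_totalDegreeLE (j : Fin 2) {ρ : ℝ[X][X]} (hρ : ρ ∈ totalDegreeLE ℝ 1)
    (i : Fin 3) : d.angQuad j ρ i ∈ totalDegreeLE ℝ 2 := by
  have h2 : ρ ^ 2 ∈ totalDegreeLE ℝ 2 := by
    rw [pow_two]
    exact mul_mem_totalDegreeLE hρ hρ le_rfl
  exact add_mem (add_mem (mul_mem_totalDegreeLE h2 (toVec_mem_totalDegreeLE _ 0 i) le_rfl)
    (mul_mem_totalDegreeLE hρ (toVec_mem_totalDegreeLE _ 1 i) le_rfl))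
    (toVec_mem_totalDegreeLE _ 2 i)

theorem J_mem_totalDegreeLE (i : Fin 3) : d.J (X : ℝ[X][X]) (C X) i ∈ totalDegreeLE ℝ 2 :=
  sub_mem (d.angQuad_mem_totalDegreeLE 1 C_X_mem_totalDegreeLE i)
    (d.angQuad_mem_totalDegreeLE 0 X_mem_totalDegreeLE i)

theorem qPoly_mem_totalDegreeLE : d.qPoly ∈ totalDegreeLE ℝ 2 :=
  dot_mem_totalDegreeLE d.J_mem_totalDegreeLE (toVec_mem_totalDegreeLE _ 0) le_rfl

theorem ρdot_mem_totalDegreeLE (j : Fin 2) : d.ρdot j (X : ℝ[X][X]) (C X) ∈ totalDegreeLE ℝ 2 :=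
  real_smul_mem_totalDegreeLE _
    (dot_mem_totalDegreeLE d.J_mem_totalDegreeLE (toVec_mem_totalDegreeLE _ 0) le_rfl)

theorem r_mem_totalDegreeLE (j : Fin 2) (i : Fin 3) : d.r j (X : ℝ[X][X]) (C X) i ∈
    totalDegreeLE ℝ 1 :=
  add_mem (toVec_mem_totalDegreeLE _ 1 i)
    (mul_mem_totalDegreeLE (unknown_mem_totalDegreeLE j) (toVec_mem_totalDegreeLE _ 0 i) le_rfl)

/-- The part `q̇ + ρ e^⊥` of the velocity. -/
noncomputable def rdotPerp {R : Type*} [CommRing R] [Algebra ℝ R] (j : Fin 2) (ρ₁ ρ₂ : R) :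
    Fin 3 → R :=
  toVec R (d.vel j) + (![ρ₁, ρ₂] : Fin 2 → R) j • toVec R (d.ePerp j)

theorem rdot_eq {R : Type*} [CommRing R] [Algebra ℝ R] (j : Fin 2) (ρ₁ ρ₂ : R) :
    d.rdot j ρ₁ ρ₂ = d.rdotPerp j ρ₁ ρ₂ + d.ρdot j ρ₁ ρ₂ • toVec R (d.e j) := by
  rw [rdot, rdotPerp, add_right_comm]

theorem rdotPerp_mem_totalDegreeLE (j : Fin 2) (i : Fin 3) :
    d.rdotPerp j (X : ℝ[X][X]) (C X) i ∈
    totalDegreeLE ℝ 1 :=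
  add_mem (toVec_mem_totalDegreeLE _ 1 i)
    (mul_mem_totalDegreeLE (unknown_mem_totalDegreeLE j) (toVec_mem_totalDegreeLE _ 0 i) le_rfl)

theorem rdot_mem_totalDegreeLE (j : Fin 2) (i : Fin 3) :
    d.rdot j (X : ℝ[X][X]) (C X) i ∈ totalDegreeLE ℝ 2 := by
  rw [rdot_eq]
  exact add_mem (totalDegreeLE_mono one_le_two (d.rdotPerp_mem_totalDegreeLE j i))
    (mul_mem_totalDegreeLE (d.ρdot_mem_totalDegreeLE j) (toVec_mem_totalDegreeLE _ 0 i) le_rfl)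

theorem p_eq {R : Type*} [CommRing R] [Algebra ℝ R] (j : Fin 2) (ρ₁ ρ₂ : R) :
    d.p j ρ₁ ρ₂ = ((d.K j ρ₁ ρ₂ - d.K (1 - j) ρ₁ ρ₂) ⨯₃ (d.r j ρ₁ ρ₂ - d.r (1 - j) ρ₁ ρ₂)) ⬝ᵥ
      toVec R (d.e j) := by
  fin_cases j
  · rfl
  · simp only [p, ξ, dot_three, cross_zero, cross_one, cross_two, Pi.sub_apply, Fin.mk_one, sub_self]
    ring

/-- Counting degrees in `(K₁ - K₂) × (r₁ - r₂)` gives only 6. Projection on `e_j` removes the terms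
in which `ρ_j e_j` and `ρ̇_j e_j` enter directly, and `cross_dot_expand` displays what is left, of
degree 5. -/
theorem pPoly_mem_totalDegreeLE (j : Fin 2) : d.pPoly j ∈ totalDegreeLE ℝ 5 := by
  have hs : ∀ j, (1 / 2 : ℝ) • (d.rdot j (X : ℝ[X][X]) (C X) ⬝ᵥ d.rdot j X (C X)) ∈
      totalDegreeLE ℝ 4 :=
    fun j => real_smul_mem_totalDegreeLE _
      (dot_mem_totalDegreeLE (d.rdot_mem_totalDegreeLE j) (d.rdot_mem_totalDegreeLE j) le_rfl)
  have ht : ∀ j, d.rdot j (X : ℝ[X][X]) (C X) ⬝ᵥ d.r j (X : ℝ[X][X]) (C X) ∈ totalDegreeLE ℝ 3 :=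
    fun j => dot_mem_totalDegreeLE (d.rdot_mem_totalDegreeLE j) (d.r_mem_totalDegreeLE j) le_rfl
  have hw : ∀ i, ((toVec _ (d.pos j) - d.r (1 - j) (X : ℝ[X][X]) (C X)) ⨯₃ toVec _ (d.e j)) i ∈
      totalDegreeLE ℝ 1 :=
    cross_mem_totalDegreeLE (fun i => sub_mem (toVec_mem_totalDegreeLE _ 1 i)
      (d.r_mem_totalDegreeLE _ i)) (toVec_mem_totalDegreeLE _ 0) le_rfl
  have hK : ∀ j, d.K j (X : ℝ[X][X]) (C X) =
      ((1 / 2 : ℝ) • (d.rdot j (X : ℝ[X][X]) (C X) ⬝ᵥ d.rdot j X (C X))) •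
      d.r j (X : ℝ[X][X]) (C X) - (d.rdot j (X : ℝ[X][X]) (C X) ⬝ᵥ d.r j (X : ℝ[X][X]) (C X)) •
        (d.rdotPerp j (X : ℝ[X][X]) (C X) + d.ρdot j (X : ℝ[X][X]) (C X) • toVec ℝ[X][X] (d.e j)) := by
    intro j
    rw [K, ← smul_assoc, ← rdot_eq]
  rw [pPoly, p_eq, hK, hK]
  generalize hs1 : (1 / 2 : ℝ) • (d.rdot j (X : ℝ[X][X]) (C X) ⬝ᵥ d.rdot j X (C X)) = s₁
  generalize hs2 : (1 / 2 : ℝ) • (d.rdot (1 - j) (X : ℝ[X][X]) (C X) ⬝ᵥ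
    d.rdot (1 - j) X (C X)) = s₂
  generalize ht1 : d.rdot j (X : ℝ[X][X]) (C X) ⬝ᵥ d.r j (X : ℝ[X][X]) (C X) = t₁
  generalize ht2 : d.rdot (1 - j) (X : ℝ[X][X]) (C X) ⬝ᵥ d.r (1 - j) (X : ℝ[X][X]) (C X) = t₂
  have hs₁ := hs1 ▸ hs j
  have hs₂ := hs2 ▸ hs (1 - j)
  have ht₁ := ht1 ▸ ht j
  have ht₂ := ht2 ▸ ht (1 - j)
  have hr := d.r_mem_totalDegreeLE (1 - j)
  rw [r] at hw hr
  rw [r, r, cross_dot_expand]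
  refine add_mem (add_mem (sub_mem (sub_mem ?_ ?_) ?_) ?_) ?_
  · exact mul_mem_totalDegreeLE hs₁ (dot_mem_totalDegreeLE (toVec_mem_totalDegreeLE _ 0) hw le_rfl)
      le_rfl
  · exact mul_mem_totalDegreeLE ht₁ (dot_mem_totalDegreeLE (d.rdotPerp_mem_totalDegreeLE j) hw le_rfl)
      le_rfl
  · exact mul_mem_totalDegreeLE hs₂ (dot_mem_totalDegreeLE hr (cross_mem_totalDegreeLE
      (toVec_mem_totalDegreeLE _ 0) (toVec_mem_totalDegreeLE _ 0) le_rfl) le_rfl) le_rfl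
  · exact mul_mem_totalDegreeLE ht₂ (dot_mem_totalDegreeLE (d.rdotPerp_mem_totalDegreeLE _) hw le_rfl)
      le_rfl
  · exact mul_mem_totalDegreeLE (mul_mem_totalDegreeLE ht₂ (d.ρdot_mem_totalDegreeLE _) le_rfl)
      (dot_mem_totalDegreeLE (toVec_mem_totalDegreeLE _ 0) (cross_mem_totalDegreeLE (fun i =>
        sub_mem (toVec_mem_totalDegreeLE _ 0 i) (toVec_mem_totalDegreeLE _ 0 i))
        (toVec_mem_totalDegreeLE _ 0) le_rfl) le_rfl) le_rfl

end Degrees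

/-- The resultant of `p_j` and `q` with respect to `ρ₁`, formed with the degrees `5` and `2`. -/
noncomputable def elim (j : Fin 2) : ℝ[X] := resultant (d.pPoly j) d.qPoly 5 2

theorem natDegree_elim_le (j : Fin 2) : (d.elim j).natDegree ≤ 10 :=
  natDegree_resultant_le (d.pPoly_mem_totalDegreeLE j) d.qPoly_mem_totalDegreeLE

theorem natDegree_pPoly_le (j : Fin 2) : (d.pPoly j).natDegree ≤ 5 :=
  natDegree_le_of_mem_totalDegreeLE (d.pPoly_mem_totalDegreeLE j)

theorem natDegree_qPoly_le : d.qPoly.natDegree ≤ 2 :=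
  natDegree_le_of_mem_totalDegreeLE d.qPoly_mem_totalDegreeLE

/-- The leading coefficient of `losMomentum`. -/
noncomputable def losLead (j : Fin 2) : ℝ := d.e j ⬝ᵥ d.pos j ⨯₃ d.ePerp j

/-- The leading coefficient of `crossTerm`. -/
noncomputable def crossLead (j : Fin 2) : ℝ := d.e j ⬝ᵥ d.D (1 - j)

theorem losMomentum_poly (j : Fin 2) :
    (d.losMomentum j X : ℝ[X]) = C (d.losLead j) * X + C (d.e j ⬝ᵥ d.G j) := rfl

theorem crossTerm_poly (j : Fin 2) :
    (d.crossTerm j X : ℝ[X]) = C (d.crossLead j) * X + C (d.pos j ⬝ᵥ d.D (1 - j)) := rfl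

theorem losMomentum_X : (d.losMomentum 0 X : ℝ[X][X]) =
    C (C (d.losLead 0)) * X + C (C (d.e 0 ⬝ᵥ d.G 0)) := rfl

theorem losMomentum_C_X : (d.losMomentum 1 (C X) : ℝ[X][X]) = C (d.losMomentum 1 X) := by
  rw [losMomentum_poly, map_add, map_mul]
  rfl

theorem qPoly_eq : d.qPoly = C (C (-(d.losLead 0 * d.crossLead 0))) * X ^ 2
    + C (C (-(d.losLead 0 * (d.pos 0 ⬝ᵥ d.D 1) + (d.e 0 ⬝ᵥ d.G 0) * d.crossLead 0))) * X
    + C (-(C ((d.e 0 ⬝ᵥ d.G 0) * (d.pos 0 ⬝ᵥ d.D 1)) + d.losMomentum 1 X * d.crossTerm 1 X)) := by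
  have h1 : (d.crossTerm 0 X : ℝ[X][X]) =
      C (C (d.crossLead 0)) * X + C (C (d.pos 0 ⬝ᵥ d.D 1)) := rfl
  have h2 : (d.crossTerm 1 (C X) : ℝ[X][X]) = C (d.crossTerm 1 X) := by
    rw [crossTerm_poly, map_add, map_mul]
    rfl
  rw [qPoly, q_eq, h1, h2, losMomentum_X, losMomentum_C_X]
  simp only [map_neg, map_add, map_mul]
  ring

theorem coeff_qPoly_two : d.qPoly.coeff 2 = C (-(d.losLead 0 * d.crossLead 0)) := by
  rw [qPoly_eq]
  simp only [coeff_add, coeff_C_mul, coeff_X_pow, coeff_X, coeff_C]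
  simp

theorem coeff_qPoly_one : d.qPoly.coeff 1 =
    C (-(d.losLead 0 * (d.pos 0 ⬝ᵥ d.D 1) + (d.e 0 ⬝ᵥ d.G 0) * d.crossLead 0)) := by
  rw [qPoly_eq]
  simp only [coeff_add, coeff_C_mul, coeff_X_pow, coeff_X, coeff_C]
  simp

theorem coeff_qPoly_zero : d.qPoly.coeff 0 =
    -(C ((d.e 0 ⬝ᵥ d.G 0) * (d.pos 0 ⬝ᵥ d.D 1)) + d.losMomentum 1 X * d.crossTerm 1 X) := by
  rw [qPoly_eq]
  simp

theorem natDegree_qPoly (h : d.losLead 0 * d.crossLead 0 ≠ 0) : d.qPoly.natDegree = 2 := by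
  refine natDegree_eq_of_le_of_coeff_ne_zero d.natDegree_qPoly_le ?_
  rw [coeff_qPoly_two]
  simpa using h

/-- The nominal degrees 5 and 2 make `elim` depend uniformly on the data, while `u` uses the actual
degrees; the discrepancy is a power of the constant leading coefficient of `qPoly`. -/
theorem elim_eq_C_mul_u (h : d.losLead 0 * d.crossLead 0 ≠ 0) (j : Fin 2) :
    ∃ c : ℝ, c ≠ 0 ∧ d.elim j = C c * d.u j := by
  obtain ⟨k, hk⟩ := le_iff_exists_add.mp (d.natDegree_pPoly_le j)
  refine ⟨(-(d.losLead 0 * d.crossLead 0)) ^ k, pow_ne_zero _ (neg_ne_zero.2 h), ?_⟩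
  rw [elim, hk, resultant_add_left_deg _ _ _ _ _ le_rfl, u, d.natDegree_qPoly h, coeff_qPoly_two]
  simp

/-- `p_mul_losMomentum` holds in every commutative `ℝ`-algebra at any zero of `q`, and the classes
of the two indeterminates modulo `qPoly` form such a zero. No irreducibility of the conic is needed.
-/
theorem qPoly_dvd (hN : d.DD ⬝ᵥ d.DD ≠ 0) :
    d.qPoly ∣ d.pPoly 0 * C (d.losMomentum 1 X) - d.pPoly 1 * d.losMomentum 0 X := by
  rw [← Ideal.mem_span_singleton, ← Ideal.Quotient.eq_zero_iff_mem,
    ← Ideal.Quotient.mkₐ_eq_mk ℝ]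
  set φ := Ideal.Quotient.mkₐ ℝ (Ideal.span {d.qPoly})
  have hq : d.q (φ X) (φ (C X)) = 0 := by
    rw [← map_q]
    exact (Ideal.Quotient.eq_zero_iff_mem).2 (Ideal.mem_span_singleton_self _)
  have h := d.p_mul_losMomentum hN hq
  rw [← map_p, ← map_p] at h
  have hl : ∀ (j : Fin 2) (ρ : ℝ[X][X]), φ (d.losMomentum j ρ) = d.losMomentum j (φ ρ) := by
    intro j ρ
    simp only [losMomentum, map_add, map_mul, AlgHom.commutes]
  rw [← losMomentum_C_X, map_sub, map_mul, map_mul, hl, hl]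
  exact sub_eq_zero.2 h

theorem natDegree_losMomentum_X_le : (d.losMomentum 0 X : ℝ[X][X]).natDegree ≤ 1 := by
  rw [losMomentum_X]
  exact natDegree_linear_le

/-- At the zero of `ℓ₁` the term `ℓ₁ m₁` of `q` drops out and `-ℓ₂ m₂` remains. -/
theorem resultant_losMomentum_X : resultant (d.losMomentum 0 X) d.qPoly 1 2 =
    -(C (d.losLead 0) ^ 2 * (d.losMomentum 1 X * d.crossTerm 1 X)) := by
  rw [losMomentum_X, resultant_linear_left, coeff_qPoly_two, coeff_qPoly_one, coeff_qPoly_zero]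
  simp only [map_neg, map_add, map_mul]
  ring

theorem exists_pPoly_mul_eq (hN : d.DD ⬝ᵥ d.DD ≠ 0) (hL : d.losLead 0 * d.crossLead 0 ≠ 0) :
    ∃ h : ℝ[X][X], h.natDegree + 2 ≤ 5 + 1 ∧ d.pPoly 0 * C (d.losMomentum 1 X) =
      d.pPoly 1 * d.losMomentum 0 X + d.qPoly * h := by
  replace hL := d.natDegree_qPoly hL
  obtain ⟨h, hh⟩ := d.qPoly_dvd hN
  refine ⟨h, ?_, sub_eq_iff_eq_add'.1 hh⟩
  by_cases h0 : h = 0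
  · simp [h0]
  have hq0 : d.qPoly ≠ 0 := ne_zero_of_natDegree_gt (n := 1) (by lia)
  have h1 := natDegree_mul_le_of_le (d.natDegree_pPoly_le 0) (natDegree_C (d.losMomentum 1 X)).le
  have h2 := natDegree_mul_le_of_le (d.natDegree_pPoly_le 1) d.natDegree_losMomentum_X_le
  have h3 := natDegree_sub_le_of_le (h1.trans (by simp : 5 + 0 ≤ 5 + 1)) h2
  rw [hh, natDegree_mul hq0 h0, hL, max_self] at h3
  lia

theorem losMomentum_ne_zero {j : Fin 2} (h : d.losLead j ≠ 0) : (d.losMomentum j X : ℝ[X]) ≠ 0 := by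
  intro h0
  have := congrArg (fun p => coeff p 1) h0
  simp [losMomentum_poly, coeff_C, h] at this

theorem elim_mul_losMomentum_sq (hN : d.DD ⬝ᵥ d.DD ≠ 0) (hL : d.losLead 0 * d.crossLead 0 ≠ 0) :
    C (-(d.losLead 0 * d.crossLead 0)) * (d.elim 0 * d.losMomentum 1 X ^ 2) =
      d.elim 1 * -(C (d.losLead 0) ^ 2 * (d.losMomentum 1 X * d.crossTerm 1 X)) := by
  obtain ⟨h, hdeg, hh⟩ := d.exists_pPoly_mul_eq hN hL
  rw [elim, elim]
  exact resultant_mul_eq_of_eq_add_mul (d.natDegree_pPoly_le 0) (d.natDegree_pPoly_le 1)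
    d.natDegree_losMomentum_X_le d.natDegree_qPoly_le hdeg hh d.resultant_losMomentum_X
    d.coeff_qPoly_two

/-- The relation between the two eliminants. -/
theorem losMomentum_mul_elim (hN : d.DD ⬝ᵥ d.DD ≠ 0) (h₀ : d.losLead 0 ≠ 0) (h₁ : d.losLead 1 ≠ 0)
    (hc : d.crossLead 0 ≠ 0) :
    C (d.crossLead 0) * (d.losMomentum 1 X * d.elim 0) =
      C (d.losLead 0) * (d.crossTerm 1 X * d.elim 1) :=
  C_mul_eq_C_mul_of_neg_mul_eq h₀ (d.losMomentum_ne_zero h₁)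
    (d.elim_mul_losMomentum_sq hN (mul_ne_zero h₀ hc))

end Data

/-! ### Common factors and roots in one variable -/

section Univariate

theorem isCoprime_linear {a b a' b' : ℝ} (h : a * b' - b * a' ≠ 0) :
    IsCoprime (C a * X + C b : ℝ[X]) (C a' * X + C b') := by
  refine ⟨C (-(a * b' - b * a')⁻¹ * a'), C ((a * b' - b * a')⁻¹ * a), ?_⟩
  have : (C ((a * b' - b * a')⁻¹ * (a * b' - b * a')) : ℝ[X]) = 1 := by
    rw [inv_mul_cancel₀ h, C_1]
  rw [← this]
  simp only [C_mul, C_sub, C_neg]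
  ring

/-- `m` divides `l * u` up to a unit and is coprime to `l`, so it divides `u`. -/
theorem exists_common_factor {l m u v : ℝ[X]} {a b : ℝ} (ha : a ≠ 0) (hb : b ≠ 0) (hm : m ≠ 0)
    (hlm : IsCoprime l m) (h : C b * (l * u) = C a * (m * v)) :
    ∃ w, u = m * w ∧ v = C (a⁻¹ * b) * (l * w) := by
  have hdvd : m ∣ u := by
    have h1 : m ∣ C b * (l * u) := h ▸ (dvd_mul_right m v).mul_left _
    have h2 : m ∣ l * u := ((isUnit_C.2 hb.isUnit).dvd_mul_left).1 h1
    exact hlm.symm.dvd_of_dvd_mul_left h2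
  obtain ⟨w, rfl⟩ := hdvd
  refine ⟨w, rfl, mul_left_cancel₀ hm ?_⟩
  have : (C (a⁻¹ * a) : ℝ[X]) = 1 := by rw [inv_mul_cancel₀ ha, C_1]
  rw [C_mul] at this ⊢
  linear_combination (-(m * v)) * this - C a⁻¹ * h

theorem natDegree_gcd_of_common_factor {l m w : ℝ[X]} {s t : ℝ} (hs : s ≠ 0) (ht : t ≠ 0)
    (hlm : IsCoprime l m) :
    (EuclideanDomain.gcd (C s * (m * w)) (C t * (l * w))).natDegree = w.natDegree := by
  refine natDegree_eq_of_degree_eq (degree_eq_degree_of_associated (associated_of_dvd_dvd ?_ ?_))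
  · obtain ⟨x, y, hxy⟩ := hlm
    have h1 := EuclideanDomain.gcd_dvd_left (C s * (m * w)) (C t * (l * w))
    have h2 := EuclideanDomain.gcd_dvd_right (C s * (m * w)) (C t * (l * w))
    rw [(isUnit_C.2 hs.isUnit).dvd_mul_left] at h1
    rw [(isUnit_C.2 ht.isUnit).dvd_mul_left] at h2
    have h3 := dvd_add (h2.mul_left x) (h1.mul_left y)
    have e : x * (l * w) + y * (m * w) = w := by linear_combination w * hxy
    rwa [e] at h3
  · exact EuclideanDomain.dvd_gcd (dvd_mul_of_dvd_right (dvd_mul_left _ _) _)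
      (dvd_mul_of_dvd_right (dvd_mul_left _ _) _)

theorem encard_roots {w : ℝ[X]} (hw : w.Separable) :
    {z : ℂ | aeval z w = 0}.encard = w.natDegree := by
  have h0 : w ≠ 0 := hw.ne_zero
  have hs : {z : ℂ | aeval z w = 0} = w.rootSet ℂ := by
    ext z
    simp [mem_rootSet, h0]
  rw [hs, Set.encard_eq_coe_toFinset_card, Set.toFinset_card,
    card_rootSet_eq_natDegree hw (IsAlgClosed.splits _)]

theorem Separable.derivative_aeval_ne_zero {p : ℝ[X]} (hp : p.Separable) {z : ℂ}
    (hz : aeval z p = 0) : aeval z (derivative p) ≠ 0 := by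
  intro h
  obtain ⟨a, b, hab⟩ := hp
  have := congrArg (aeval z) hab
  simp [hz, h] at this

end Univariate

/-! ### Common zeros and roots of the resultant -/

section Bivariate

variable {p q : ℝ[X][X]} {L : ℝ}

/-- The leading coefficient of `q` in the outer variable is a nonzero real constant, so `q` can be
normalized to be monic and `p` divided by it. -/
theorem exists_eq_linear_add_mul (hp : p.natDegree ≤ 5) (hq : q.natDegree ≤ 2)
    (hL : L ≠ 0) (hqL : q.coeff 2 = C L) :
    ∃ a b h, h.natDegree + 2 ≤ 1 + 4 ∧ p = C a * X + C b + q * h := by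
  have hLL : (C (C L⁻¹) * C (C L) : ℝ[X][X]) = 1 := by
    rw [← C_mul, ← C_mul, inv_mul_cancel₀ hL, C_1, C_1]
  have hq2 : q.natDegree = 2 := natDegree_eq_of_le_of_coeff_ne_zero hq (by simpa [hqL] using hL)
  set g := C (C L⁻¹) * q
  have hgn : g.natDegree = 2 := by
    rw [natDegree_C_mul (by simpa using hL), hq2]
  have hg : g.Monic := by
    rw [Monic, leadingCoeff, hgn, coeff_C_mul, hqL, ← C_mul, inv_mul_cancel₀ hL, C_1]
  have h1 : (p %ₘ g).natDegree ≤ 1 := by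
    have := natDegree_modByMonic_lt p hg (by intro h; simp [h] at hgn)
    lia
  refine ⟨(p %ₘ g).coeff 1, (p %ₘ g).coeff 0, C (C L⁻¹) * (p /ₘ g), ?_, ?_⟩
  · have h2 := natDegree_divByMonic p hg
    have h3 := natDegree_C_mul_le (C L⁻¹) (p /ₘ g)
    lia
  · rw [← eq_X_add_C_of_natDegree_le_one h1]
    conv_lhs => rw [← modByMonic_add_div p g]
    ring

theorem aeval_map_eval (x y : ℂ) (p : ℝ[X][X]) :
    (p.map (aeval y : ℝ[X] →ₐ[ℝ] ℂ).toRingHom).eval x = aevalAeval y x p := by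
  rw [eval_map]
  induction p using Polynomial.induction_on' with
  | add p q hp hq => rw [eval₂_add, hp, hq, map_add]
  | monomial n a =>
    rw [eval₂_monomial, ← C_mul_X_pow_eq_monomial, map_mul, map_pow, aevalAeval_C, aevalAeval_Y]
    rfl

/-- After specialization `q` still has degree exactly 2, so the resultant is, up to a nonzero
factor, the product of the values of `p` at the roots of `q`. A drop in the degree of `p` does no
harm. -/
theorem exists_common_root (hp : p.natDegree ≤ 5) (hq : q.natDegree ≤ 2)
    (hL : L ≠ 0) (hqL : q.coeff 2 = C L) {y : ℂ} (h : aeval y (resultant p q 5 2) = 0) :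
    ∃ x, aevalAeval y x q = 0 ∧ aevalAeval y x p = 0 := by
  set φ := (aeval y : ℝ[X] →ₐ[ℝ] ℂ).toRingHom
  have h1 : resultant (p.map φ) (q.map φ) 5 2 = 0 := by
    rw [resultant_map_map]
    exact h
  have hq2 : (q.map φ).natDegree = 2 := by
    refine natDegree_eq_of_le_of_coeff_ne_zero (natDegree_map_le.trans hq) ?_
    rw [coeff_map, hqL]
    simpa [φ] using hL
  rw [resultant_comm, ← hq2, resultant_eq_prod_eval _ _ _ (natDegree_map_le.trans hp)
    (IsAlgClosed.splits _)] at h1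
  have hlc : (q.map φ).leadingCoeff ≠ 0 := by
    intro h0
    rw [leadingCoeff_eq_zero] at h0
    simp [h0] at hq2
  have h2 : ((q.map φ).roots.map (p.map φ).eval).prod = 0 := by
    simpa [hlc] using h1
  rw [Multiset.prod_eq_zero_iff, Multiset.mem_map] at h2
  obtain ⟨x, hx, hx'⟩ := h2
  exact ⟨x, by rw [← aeval_map_eval]; exact isRoot_of_mem_roots hx,
    by rw [← aeval_map_eval]; exact hx'⟩

theorem aeval_resultant_eq_zero (hp : p.natDegree ≤ 5) (hq : q.natDegree ≤ 2) {x y : ℂ}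
    (hqx : aevalAeval y x q = 0) (hpx : aevalAeval y x p = 0) :
    aeval y (resultant p q 5 2) = 0 := by
  obtain ⟨a, b, -, -, e⟩ := exists_mul_add_mul_eq_C_resultant p q hp hq (by simp)
  have := congrArg (aevalAeval y x) e
  rw [map_add, map_mul, map_mul, hqx, hpx, aevalAeval_C] at this
  simpa using this.symm

/-- The remainder `a X + b` of `p` modulo `q` vanishes at two distinct points above `y`, so `a(y) =
b(y) = 0`. The resultant is a quadratic form in `a, b` times a constant, hence vanishes doubly at
`y`. -/
theorem aeval_derivative_resultant_eq_zero (hp : p.natDegree ≤ 5) (hq : q.natDegree ≤ 2)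
    (hL : L ≠ 0) (hqL : q.coeff 2 = C L) {x x' y : ℂ} (hx : x ≠ x')
    (hqx : aevalAeval y x q = 0) (hpx : aevalAeval y x p = 0)
    (hqx' : aevalAeval y x' q = 0) (hpx' : aevalAeval y x' p = 0) :
    aeval y (derivative (resultant p q 5 2)) = 0 := by
  obtain ⟨a, b, h, hh, e⟩ := exists_eq_linear_add_mul hp hq hL hqL
  have hr := resultant_of_eq_linear_add_mul hq hh e
  have ev : ∀ z, aevalAeval y z q = 0 → aevalAeval y z p = 0 → aeval y a * z + aeval y b = 0 := by
    intro z hz hz'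
    rw [e, map_add, map_mul, map_add, map_mul, aevalAeval_C, aevalAeval_C, aevalAeval_Y, hz] at hz'
    simpa using hz'
  have e1 := ev x hqx hpx
  have e2 := ev x' hqx' hpx'
  have ha : aeval y a = 0 := by
    have : aeval y a * (x - x') = 0 := by linear_combination e1 - e2
    exact (mul_eq_zero.1 this).resolve_right (sub_ne_zero.2 hx)
  have hb : aeval y b = 0 := by simpa [ha] using e1
  rw [show (5 : ℕ) = 1 + 4 from rfl, hr]
  simp [ha, hb, derivative_mul, pow_two]

end Bivariate

/-! ### The nine solutions for nondegenerate data -/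

namespace Data

variable (d : Data)

/-- The nondegeneracy conditions on the data under which the system has nine solutions. -/
structure IsNondegenerate : Prop where
  DD_ne : d.DD ⬝ᵥ d.DD ≠ 0
  los_ne : ∀ j, d.losLead j ≠ 0
  cross_ne : ∀ j, d.crossLead j ≠ 0
  det_ne : d.losLead 1 * (d.pos 1 ⬝ᵥ d.D 0) - (d.e 1 ⬝ᵥ d.G 1) * d.crossLead 1 ≠ 0
  vol_ne : (d.pos 0 - d.pos 1) ⬝ᵥ (d.e 0 ⨯₃ d.e 1) ≠ 0
  natDegree_elim : (d.elim 0).natDegree = 10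
  separable_elim : ∀ j, (d.elim j).Separable

variable {d}

/-- In `aevalAeval y x` the inner variable `ρ₂` takes the value `y` and the outer variable `ρ₁` the
value `x`. -/
theorem aevalAeval_qPoly (x y : ℂ) : aevalAeval y x d.qPoly = d.q x y := by
  rw [qPoly, map_q, aevalAeval_Y, aevalAeval_X]

theorem aevalAeval_pPoly (j : Fin 2) (x y : ℂ) : aevalAeval y x (d.pPoly j) = d.p j x y := by
  rw [pPoly, map_p, aevalAeval_Y, aevalAeval_X]

theorem aeval_losMomentum (y : ℂ) : aeval y (d.losMomentum 1 X : ℝ[X]) = d.losMomentum 1 y := by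
  simp only [losMomentum, map_add, map_mul, aeval_X, AlgHom.commutes]

namespace IsNondegenerate

theorem leading_ne (h : d.IsNondegenerate) : -(d.losLead 0 * d.crossLead 0) ≠ 0 :=
  neg_ne_zero.2 (mul_ne_zero (h.los_ne 0) (h.cross_ne 0))

theorem aeval_u_eq_zero_iff (h : d.IsNondegenerate) (j : Fin 2) (y : ℂ) :
    aeval y (d.u j) = 0 ↔ aeval y (d.elim j) = 0 := by
  obtain ⟨c, hc, e⟩ := d.elim_eq_C_mul_u (mul_ne_zero (h.los_ne 0) (h.cross_ne 0)) j
  rw [e, map_mul, aeval_C, mul_eq_zero,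
    or_iff_right ((_root_.map_ne_zero (algebraMap ℝ ℂ)).2 hc)]

theorem mem_solutions_iff (h : d.IsNondegenerate) (x y : ℂ) :
    (x, y) ∈ d.solutions ↔ d.q x y = 0 ∧ d.p 0 x y = 0 ∧ d.p 1 x y = 0 := by
  rw [← d.ξ_eq_zero_iff h.vol_ne]
  rfl

theorem isCoprime (h : d.IsNondegenerate) :
    IsCoprime (d.losMomentum 1 X : ℝ[X]) (d.crossTerm 1 X) := by
  rw [losMomentum_poly, crossTerm_poly]
  exact isCoprime_linear h.det_ne

theorem exists_factor (h : d.IsNondegenerate) : ∃ w, d.elim 0 = d.crossTerm 1 X * w ∧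
    d.elim 1 = C ((d.losLead 0)⁻¹ * d.crossLead 0) * (d.losMomentum 1 X * w) := by
  refine exists_common_factor (h.los_ne 0) (h.cross_ne 0) ?_ h.isCoprime
    (d.losMomentum_mul_elim h.DD_ne (h.los_ne 0) (h.los_ne 1) (h.cross_ne 0))
  intro h0
  have := congrArg (fun p => coeff p 1) h0
  simp [crossTerm_poly, coeff_C, h.cross_ne 1] at this

theorem injOn (h : d.IsNondegenerate) : Set.InjOn Prod.snd d.solutions := by
  rintro ⟨x, y⟩ hx ⟨x', y'⟩ hx' (rfl : y = y')
  rw [h.mem_solutions_iff] at hx hx'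
  by_contra hne
  have hne : x ≠ x' := fun hxx => hne (by rw [hxx])
  rw [← aevalAeval_qPoly, ← aevalAeval_pPoly, ← aevalAeval_pPoly] at hx hx'
  have h1 := aeval_resultant_eq_zero (d.natDegree_pPoly_le 0) d.natDegree_qPoly_le hx.1 hx.2.1
  exact Separable.derivative_aeval_ne_zero (h.separable_elim 0) h1
    (aeval_derivative_resultant_eq_zero (d.natDegree_pPoly_le 0) d.natDegree_qPoly_le h.leading_ne
      d.coeff_qPoly_two hne hx.1 hx.2.1 hx'.1 hx'.2.1)

end IsNondegenerate

theorem IsNondegenerate.main (h : d.IsNondegenerate) :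
    d.solutions.Nonempty ∧
      (d.u 0).natDegree = 10 ∧
      (d.u 1).natDegree = 10 ∧
      (EuclideanDomain.gcd (d.u 0) (d.u 1)).natDegree = 9 ∧
      Set.BijOn Prod.snd d.solutions
        {ρ₂ : ℂ | Polynomial.aeval ρ₂ (d.u 0) = 0 ∧ Polynomial.aeval ρ₂ (d.u 1) = 0} ∧
      d.solutions.encard = 9 := by
  obtain ⟨w, hw0, hw1⟩ := h.exists_factor
  have hL := mul_ne_zero (h.los_ne 0) (h.cross_ne 0)
  obtain ⟨c₀, hc₀, e₀⟩ := d.elim_eq_C_mul_u hL 0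
  obtain ⟨c₁, hc₁, e₁⟩ := d.elim_eq_C_mul_u hL 1
  have hk : (d.losLead 0)⁻¹ * d.crossLead 0 ≠ 0 :=
    mul_ne_zero (inv_ne_zero (h.los_ne 0)) (h.cross_ne 0)
  have hlin : ∀ {a b : ℝ}, a ≠ 0 → (C a * X + C b : ℝ[X]).natDegree = 1 := natDegree_linear
  have hml : (d.crossTerm 1 X : ℝ[X]).natDegree = 1 := hlin (h.cross_ne 1)
  have hll : (d.losMomentum 1 X : ℝ[X]).natDegree = 1 := hlin (h.los_ne 1)
  have hw : w ≠ 0 := by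
    rintro rfl
    have := h.natDegree_elim
    simp [hw0] at this
  have hwd : w.natDegree = 9 := by
    have := h.natDegree_elim
    rw [hw0, natDegree_mul (ne_zero_of_natDegree_gt (n := 0) (by lia)) hw] at this
    lia
  have hd1 : (d.elim 1).natDegree = 10 := by
    rw [hw1, natDegree_C_mul hk,
      natDegree_mul (ne_zero_of_natDegree_gt (n := 0) (by lia)) hw, hwd, hll]
  have hu0 : d.u 0 = C c₀⁻¹ * (d.crossTerm 1 X * w) := by
    rw [← hw0, e₀, ← mul_assoc, ← C_mul, inv_mul_cancel₀ hc₀, C_1, one_mul]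
  have hu1 : d.u 1 = C (c₁⁻¹ * ((d.losLead 0)⁻¹ * d.crossLead 0)) * (d.losMomentum 1 X * w) := by
    rw [C_mul, mul_assoc, ← hw1, e₁, ← mul_assoc, ← C_mul, inv_mul_cancel₀ hc₁, C_1, one_mul]
  -- A Bézout relation between `ℓ₂` and `m₂`, multiplied by `w`, shows that common roots of `ℓ₂ w`
  -- and `m₂ w` are roots of `w`.
  have hroots : {ρ₂ : ℂ | aeval ρ₂ (d.u 0) = 0 ∧ aeval ρ₂ (d.u 1) = 0} =
      {ρ₂ : ℂ | aeval ρ₂ w = 0} := by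
    ext y
    simp only [Set.mem_ofPred_eq, h.aeval_u_eq_zero_iff]
    rw [hw0, hw1]
    constructor
    · rintro ⟨h1, h2⟩
      obtain ⟨s, t, hst⟩ := h.isCoprime
      rw [map_mul, aeval_C, mul_eq_zero, _root_.map_eq_zero, or_iff_right hk] at h2
      have := congrArg (aeval y) (congrArg (· * w) hst)
      simp only [map_mul, map_add, one_mul] at this h1 h2
      linear_combination aeval y s * h2 + aeval y t * h1 - this
    · intro hy
      simp [hy]
  have hsep : w.Separable := (hw0 ▸ h.separable_elim 0).of_mul_right
  have hlw : IsCoprime (d.losMomentum 1 X : ℝ[X]) w :=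
    ((hw1 ▸ h.separable_elim 1).of_mul_right).isCoprime
  have hbij : Set.BijOn Prod.snd d.solutions
      {ρ₂ : ℂ | aeval ρ₂ (d.u 0) = 0 ∧ aeval ρ₂ (d.u 1) = 0} := by
    refine ⟨?_, h.injOn, ?_⟩
    · rintro ⟨x, y⟩ hx
      rw [h.mem_solutions_iff, ← aevalAeval_qPoly, ← aevalAeval_pPoly, ← aevalAeval_pPoly] at hx
      simp only [Set.mem_ofPred_eq, h.aeval_u_eq_zero_iff]
      exact ⟨aeval_resultant_eq_zero (d.natDegree_pPoly_le 0) d.natDegree_qPoly_le hx.1 hx.2.1,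
        aeval_resultant_eq_zero (d.natDegree_pPoly_le 1) d.natDegree_qPoly_le hx.1 hx.2.2⟩
    · intro y hy
      have hwy : aeval y w = 0 := by
        rw [hroots] at hy
        exact hy
      -- It matters to start from `p₂`: the relation then reads `p₁ ℓ₂(y) = 0`, and `ℓ₂` depends on
      -- `ρ₂` only and does not vanish at roots of `w`.
      obtain ⟨x, hqx, hpx⟩ := exists_common_root (d.natDegree_pPoly_le 1) d.natDegree_qPoly_le
        h.leading_ne d.coeff_qPoly_two ((h.aeval_u_eq_zero_iff 1 y).1 hy.2)
      rw [aevalAeval_qPoly] at hqx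
      rw [aevalAeval_pPoly] at hpx
      have hl : d.losMomentum 1 y ≠ 0 := by
        intro h0
        obtain ⟨s, t, hst⟩ := hlw
        have := congrArg (aeval y) hst
        simp [aeval_losMomentum, h0, hwy] at this
      have hp0 := d.p_mul_losMomentum h.DD_ne hqx
      rw [hpx, zero_mul, mul_eq_zero, or_iff_left hl] at hp0
      exact ⟨(x, y), (h.mem_solutions_iff x y).2 ⟨hqx, hp0, hpx⟩, rfl⟩
  have hcard : d.solutions.encard = 9 := by
    rw [← hbij.injOn.encard_image, hbij.image_eq, hroots, encard_roots hsep, hwd]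
    rfl
  refine ⟨?_, ?_, ?_, ?_, hbij, hcard⟩
  · rw [← Set.encard_ne_zero, hcard]
    simp
  · rw [← h.natDegree_elim, e₀, natDegree_C_mul hc₀]
  · rw [← hd1, e₁, natDegree_C_mul hc₁]
  · rw [hu0, hu1, natDegree_gcd_of_common_factor (inv_ne_zero hc₀)
      (mul_ne_zero (inv_ne_zero hc₁) hk) h.isCoprime, hwd]


/-! ### Dependence on the data and genericity -/

/-- The functions of the data given by a polynomial in the coordinates. -/
noncomputable def polynomialFunctions : Subring (Data → ℝ) :=
  (MvPolynomial.aeval (R := ℝ) fun x (d : Data) => d.coords x).range.toSubring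

theorem mem_polynomialFunctions {f : Data → ℝ} :
    f ∈ polynomialFunctions ↔ ∃ Ψ, ∀ d : Data, f d = MvPolynomial.eval d.coords Ψ := by
  have key : ∀ (Ψ : MvPolynomial (Fin 2 × Fin 4 × Fin 3) ℝ) (d : Data),
      MvPolynomial.aeval (R := ℝ) (fun x (d : Data) => d.coords x) Ψ d =
        MvPolynomial.eval d.coords Ψ := by
    intro Ψ d
    induction Ψ using MvPolynomial.induction_on with
    | C a => simp
    | add p q hp hq => simp [hp, hq]
    | mul_X p x hp => simp [hp]
  constructor
  · rintro ⟨Ψ, rfl⟩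
    exact ⟨Ψ, fun d => key Ψ d⟩
  · rintro ⟨Ψ, h⟩
    exact ⟨Ψ, funext fun d => (key Ψ d).trans (h d).symm⟩

/-- Families of vectors with components in a ring of functions of the data. -/
def VecMem {R : Type*} [CommRing R] (S : Subring (Data → R)) (v : Data → Fin 3 → R) : Prop :=
  ∀ i, (fun d => v d i) ∈ S

section VecMem

variable {R : Type*} [CommRing R] {S : Subring (Data → R)} {v w : Data → Fin 3 → R}

theorem VecMem.add (hv : VecMem S v) (hw : VecMem S w) : VecMem S (fun d => v d + w d) :=
  fun i => S.add_mem (hv i) (hw i)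

theorem VecMem.sub (hv : VecMem S v) (hw : VecMem S w) : VecMem S (fun d => v d - w d) :=
  fun i => S.sub_mem (hv i) (hw i)

theorem VecMem.smul {a : Data → R} (ha : a ∈ S) (hv : VecMem S v) : VecMem S (fun d => a d • v d) :=
  fun i => S.mul_mem ha (hv i)

theorem VecMem.dot (hv : VecMem S v) (hw : VecMem S w) : (fun d => v d ⬝ᵥ w d) ∈ S := by
  simp only [dot_three]
  exact S.add_mem (S.add_mem (S.mul_mem (hv 0) (hw 0)) (S.mul_mem (hv 1) (hw 1)))
    (S.mul_mem (hv 2) (hw 2))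

theorem VecMem.cross (hv : VecMem S v) (hw : VecMem S w) : VecMem S (fun d => v d ⨯₃ w d) := by
  intro i
  fin_cases i
  · simp only [Fin.zero_eta, cross_zero]
    exact S.sub_mem (S.mul_mem (hv 1) (hw 2)) (S.mul_mem (hv 2) (hw 1))
  · simp only [Fin.mk_one, cross_one]
    exact S.sub_mem (S.mul_mem (hv 2) (hw 0)) (S.mul_mem (hv 0) (hw 2))
  · simp only [Fin.reduceFinMk, cross_two]
    exact S.sub_mem (S.mul_mem (hv 0) (hw 1)) (S.mul_mem (hv 1) (hw 0))

end VecMem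

section Polynomial

theorem coords_mem (x : Fin 2 × Fin 4 × Fin 3) :
    (fun d : Data => d.coords x) ∈ polynomialFunctions :=
  mem_polynomialFunctions.2 ⟨MvPolynomial.X x, fun d => by simp⟩

theorem vecMem_e (j : Fin 2) : VecMem polynomialFunctions (fun d => d.e j) :=
  fun i => coords_mem (j, 0, i)

theorem vecMem_ePerp (j : Fin 2) : VecMem polynomialFunctions (fun d => d.ePerp j) :=
  fun i => coords_mem (j, 1, i)

theorem vecMem_pos (j : Fin 2) : VecMem polynomialFunctions (fun d => d.pos j) :=
  fun i => coords_mem (j, 2, i)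

theorem vecMem_vel (j : Fin 2) : VecMem polynomialFunctions (fun d => d.vel j) :=
  fun i => coords_mem (j, 3, i)

theorem vecMem_D (j : Fin 2) : VecMem polynomialFunctions (fun d => d.D j) :=
  (vecMem_pos j).cross (vecMem_e j)

theorem vecMem_E (j : Fin 2) : VecMem polynomialFunctions (fun d => d.E j) :=
  (vecMem_e j).cross (vecMem_ePerp j)

theorem vecMem_F (j : Fin 2) : VecMem polynomialFunctions (fun d => d.F j) :=
  ((vecMem_pos j).cross (vecMem_ePerp j)).add ((vecMem_e j).cross (vecMem_vel j))

theorem vecMem_G (j : Fin 2) : VecMem polynomialFunctions (fun d => d.G j) :=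
  (vecMem_pos j).cross (vecMem_vel j)

theorem vecMem_DD : VecMem polynomialFunctions (fun d => d.DD) :=
  (vecMem_D 0).cross (vecMem_D 1)

theorem DD_dot_DD_mem : (fun d => d.DD ⬝ᵥ d.DD) ∈ polynomialFunctions :=
  vecMem_DD.dot vecMem_DD

theorem losLead_mem (j : Fin 2) : (fun d => d.losLead j) ∈ polynomialFunctions :=
  (vecMem_e j).dot ((vecMem_pos j).cross (vecMem_ePerp j))

theorem crossLead_mem (j : Fin 2) : (fun d => d.crossLead j) ∈ polynomialFunctions :=
  (vecMem_e j).dot (vecMem_D (1 - j))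

end Polynomial

/-- The quotients of polynomials in the coordinates by powers of `|D₁ × D₂|²`. -/
noncomputable def regularFunctions : Subring (Data → ℝ) where
  carrier := {f | ∃ k, f * (fun d => d.DD ⬝ᵥ d.DD) ^ k ∈ polynomialFunctions}
  zero_mem' := ⟨0, by simp⟩
  one_mem' := ⟨0, by simp⟩
  add_mem' := by
    rintro f g ⟨k, hf⟩ ⟨l, hg⟩
    refine ⟨k + l, ?_⟩
    convert polynomialFunctions.add_mem
      (polynomialFunctions.mul_mem hf (polynomialFunctions.pow_mem DD_dot_DD_mem l))
      (polynomialFunctions.mul_mem hg (polynomialFunctions.pow_mem DD_dot_DD_mem k)) using 1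
    ring
  mul_mem' := by
    rintro f g ⟨k, hf⟩ ⟨l, hg⟩
    refine ⟨k + l, ?_⟩
    convert polynomialFunctions.mul_mem hf hg using 1
    ring
  neg_mem' := by
    rintro f ⟨k, hf⟩
    refine ⟨k, ?_⟩
    rw [neg_mul]
    exact polynomialFunctions.neg_mem hf

theorem polynomialFunctions_le : polynomialFunctions ≤ regularFunctions :=
  fun f hf => ⟨0, by simpa using hf⟩

theorem inv_DD_dot_DD_mem : (fun d => (d.DD ⬝ᵥ d.DD)⁻¹) ∈ regularFunctions := by
  -- Exponent 2 is needed because the inverse of zero is zero: `N⁻¹ N² = N` also where `N = 0`,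
  -- whereas `N⁻¹ N = 1` fails there.
  refine ⟨2, ?_⟩
  convert DD_dot_DD_mem using 1
  ext d
  by_cases h : d.DD ⬝ᵥ d.DD = 0
  · simp [h]
  · simp only [Pi.mul_apply, Pi.pow_apply]
    field_simp

theorem const_mem (c : ℝ) : (fun _ => c) ∈ regularFunctions :=
  polynomialFunctions_le (mem_polynomialFunctions.2 ⟨MvPolynomial.C c, fun d => by simp⟩)

/-- A property that holds where a given regular function does not vanish is generic. -/
theorem generically_of_regular {P : Data → Prop} {f : Data → ℝ} (hf : f ∈ regularFunctions)
    {d₀ : Data} (h₀ : f d₀ ≠ 0) (h₀' : d₀.DD ⬝ᵥ d₀.DD ≠ 0)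
    (h : ∀ d : Data, f d ≠ 0 → d.DD ⬝ᵥ d.DD ≠ 0 → P d) : Generically P := by
  obtain ⟨k, hk⟩ := hf
  -- One more factor `|D₁ × D₂|²` than the denominator requires, so that `Ψ ≠ 0` forces `D₁ × D₂` to
  -- be nondegenerate even when `k = 0`.
  obtain ⟨Ψ, hΨ⟩ := mem_polynomialFunctions.1 (polynomialFunctions.mul_mem hk DD_dot_DD_mem)
  simp only [Pi.mul_apply, Pi.pow_apply] at hΨ
  refine ⟨Ψ, ⟨d₀, ?_⟩, fun d hd => ?_⟩
  · rw [← hΨ]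
    exact mul_ne_zero (mul_ne_zero h₀ (pow_ne_zero _ h₀')) h₀'
  · rw [← hΨ] at hd
    exact h d (left_ne_zero_of_mul (left_ne_zero_of_mul hd)) (right_ne_zero_of_mul hd)

theorem unknown_mem {R : Type*} [CommRing R] {S : Subring (Data → R)} {ρ₁ ρ₂ : R}
    (h₁ : (fun _ => ρ₁) ∈ S) (h₂ : (fun _ => ρ₂) ∈ S) (j : Fin 2) :
    (fun _ => (![ρ₁, ρ₂] : Fin 2 → R) j) ∈ S := by
  fin_cases j
  · exact h₁
  · exact h₂

section Expressions

variable {R : Type*} [CommRing R] [Algebra ℝ R] {S : Subring (Data → R)}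

/-- `hS` says that `S` contains the regular functions as constants. It is applied with `R = ℝ[X][X]`
and `S` the families with regular coefficients, which shows without computation that the
coefficients of `elim` are regular. -/
theorem vecMem_toVec (hS : ∀ f ∈ regularFunctions, (fun d => algebraMap ℝ R (f d)) ∈ S)
    {v : Data → Fin 3 → ℝ} (hv : VecMem polynomialFunctions v) : VecMem S (fun d => toVec R (v d)) :=
  fun i => hS _ (polynomialFunctions_le (hv i))

theorem real_smul_mem (hS : ∀ f ∈ regularFunctions, (fun d => algebraMap ℝ R (f d)) ∈ S)
    {c : Data → ℝ} (hc : c ∈ regularFunctions) {f : Data → R} (hf : f ∈ S) :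
    (fun d => c d • f d) ∈ S := by
  simp only [Algebra.smul_def]
  exact S.mul_mem (hS _ hc) hf

theorem vecMem_angQuad
    (hS : ∀ f ∈ regularFunctions, (fun d => algebraMap ℝ R (f d)) ∈ S)
    (j : Fin 2) {ρ : R} (h : (fun _ => ρ) ∈ S) :
    VecMem S (fun d => d.angQuad j ρ) :=
  ((VecMem.smul (S.pow_mem h 2) (vecMem_toVec hS (vecMem_E j))).add
    (VecMem.smul h (vecMem_toVec hS (vecMem_F j)))).add (vecMem_toVec hS (vecMem_G j))

theorem vecMem_J
    (hS : ∀ f ∈ regularFunctions, (fun d => algebraMap ℝ R (f d)) ∈ S)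
    {ρ₁ ρ₂ : R} (h₁ : (fun _ => ρ₁) ∈ S) (h₂ : (fun _ => ρ₂) ∈ S) :
    VecMem S (fun d => d.J ρ₁ ρ₂) :=
  (vecMem_angQuad hS 1 h₂).sub (vecMem_angQuad hS 0 h₁)

theorem q_mem
    (hS : ∀ f ∈ regularFunctions, (fun d => algebraMap ℝ R (f d)) ∈ S)
    {ρ₁ ρ₂ : R} (h₁ : (fun _ => ρ₁) ∈ S) (h₂ : (fun _ => ρ₂) ∈ S) : (fun d => d.q ρ₁ ρ₂) ∈ S :=
  (vecMem_J hS h₁ h₂).dot (vecMem_toVec hS vecMem_DD)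

theorem ρdot_mem
    (hS : ∀ f ∈ regularFunctions, (fun d => algebraMap ℝ R (f d)) ∈ S)
    {ρ₁ ρ₂ : R} (h₁ : (fun _ => ρ₁) ∈ S) (h₂ : (fun _ => ρ₂) ∈ S) (j : Fin 2) :
    (fun d => d.ρdot j ρ₁ ρ₂) ∈ S := by
  refine real_smul_mem hS inv_DD_dot_DD_mem ((vecMem_J hS h₁ h₂).dot (vecMem_toVec hS ?_))
  fin_cases j
  · exact (vecMem_D 1).cross vecMem_DD
  · exact (vecMem_D 0).cross vecMem_DD

theorem vecMem_r
    (hS : ∀ f ∈ regularFunctions, (fun d => algebraMap ℝ R (f d)) ∈ S)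
    {ρ₁ ρ₂ : R} (h₁ : (fun _ => ρ₁) ∈ S) (h₂ : (fun _ => ρ₂) ∈ S) (j : Fin 2) :
    VecMem S (fun d => d.r j ρ₁ ρ₂) :=
  (vecMem_toVec hS (vecMem_pos j)).add
    (VecMem.smul (unknown_mem h₁ h₂ j) (vecMem_toVec hS (vecMem_e j)))

theorem vecMem_rdot
    (hS : ∀ f ∈ regularFunctions, (fun d => algebraMap ℝ R (f d)) ∈ S)
    {ρ₁ ρ₂ : R} (h₁ : (fun _ => ρ₁) ∈ S) (h₂ : (fun _ => ρ₂) ∈ S) (j : Fin 2) :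
    VecMem S (fun d => d.rdot j ρ₁ ρ₂) :=
  ((vecMem_toVec hS (vecMem_vel j)).add
    (VecMem.smul (ρdot_mem hS h₁ h₂ j) (vecMem_toVec hS (vecMem_e j)))).add
    (VecMem.smul (unknown_mem h₁ h₂ j) (vecMem_toVec hS (vecMem_ePerp j)))

theorem vecMem_K
    (hS : ∀ f ∈ regularFunctions, (fun d => algebraMap ℝ R (f d)) ∈ S)
    {ρ₁ ρ₂ : R} (h₁ : (fun _ => ρ₁) ∈ S) (h₂ : (fun _ => ρ₂) ∈ S) (j : Fin 2) :
    VecMem S (fun d => d.K j ρ₁ ρ₂) := by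
  have hr := vecMem_r hS h₁ h₂ j
  have hrd := vecMem_rdot hS h₁ h₂ j
  refine VecMem.sub (fun i => ?_) (VecMem.smul (hrd.dot hr) hrd)
  exact real_smul_mem hS (const_mem _) ((VecMem.smul (hrd.dot hrd) hr) i)

theorem p_mem
    (hS : ∀ f ∈ regularFunctions, (fun d => algebraMap ℝ R (f d)) ∈ S)
    {ρ₁ ρ₂ : R} (h₁ : (fun _ => ρ₁) ∈ S) (h₂ : (fun _ => ρ₂) ∈ S) (j : Fin 2) :
    (fun d => d.p j ρ₁ ρ₂) ∈ S :=
  (((vecMem_K hS h₁ h₂ 0).sub (vecMem_K hS h₁ h₂ 1)).cross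
    ((vecMem_r hS h₁ h₂ 0).sub (vecMem_r hS h₁ h₂ 1))).dot (vecMem_toVec hS (vecMem_e j))

end Expressions

theorem algebraMap_mem_polyFamily (f : Data → ℝ) (hf : f ∈ regularFunctions) :
    (fun d => algebraMap ℝ ℝ[X][X] (f d)) ∈ polyFamily (polyFamily regularFunctions) :=
  const_C_mem_polyFamily (const_C_mem_polyFamily hf)

theorem elim_mem (j : Fin 2) : (fun d => d.elim j) ∈ polyFamily regularFunctions :=
  have hX : (fun _ => X) ∈ polyFamily (polyFamily regularFunctions) := const_X_mem_polyFamily _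
  have hCX : (fun _ => C X) ∈ polyFamily (polyFamily regularFunctions) :=
    const_C_mem_polyFamily (const_X_mem_polyFamily _)
  resultant_mem (p_mem algebraMap_mem_polyFamily hX hCX j)
    (q_mem algebraMap_mem_polyFamily hX hCX) 5 2

/-- The resultant of an eliminant and its derivative. -/
noncomputable def elimDisc (d : Data) (j : Fin 2) : ℝ :=
  resultant (d.elim j) (derivative (d.elim j)) 10 9

theorem elimDisc_mem (j : Fin 2) : (fun d => d.elimDisc j) ∈ regularFunctions :=
  resultant_mem (elim_mem j) (derivative_mem_polyFamily (elim_mem j)) 10 9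

/-- Once the coefficient of degree 10 is nonzero, the nominal degrees 10 and 9 in `elimDisc` are the
actual ones, and the resultant with the derivative detects common factors. -/
theorem separable_elim_iff {d : Data} {j : Fin 2} (h : (d.elim j).coeff 10 ≠ 0) :
    (d.elim j).Separable ↔ d.elimDisc j ≠ 0 := by
  have h1 : (d.elim j).natDegree = 10 :=
    natDegree_eq_of_le_of_coeff_ne_zero (d.natDegree_elim_le j) h
  have h2 : (derivative (d.elim j)).natDegree = 9 := by
    rw [natDegree_derivative, h1]
  have h3 := resultant_eq_zero_iff (f := d.elim j) (g := derivative (d.elim j))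
  rw [h1, h2] at h3
  rw [elimDisc, Ne, h3, Separable]
  have h0 : d.elim j ≠ 0 := ne_zero_of_natDegree_gt (n := 0) (by lia)
  simp [h0]

/-- The product of the expressions whose nonvanishing makes the data nondegenerate. -/
noncomputable def genericity (d : Data) : ℝ :=
  d.losLead 0 * d.losLead 1 * (d.crossLead 0 * d.crossLead 1)
    * (d.losLead 1 * (d.pos 1 ⬝ᵥ d.D 0) - (d.e 1 ⬝ᵥ d.G 1) * d.crossLead 1)
    * ((d.pos 0 - d.pos 1) ⬝ᵥ (d.e 0 ⨯₃ d.e 1))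
    * ((d.elim 0).coeff 10 * (d.elim 1).coeff 10) * (d.elimDisc 0 * d.elimDisc 1)

theorem genericity_mem : genericity ∈ regularFunctions := by
  have hp := polynomialFunctions_le
  refine mul_mem (mul_mem (mul_mem (mul_mem (mul_mem ?_ ?_) ?_) ?_) ?_) ?_
  · exact mul_mem (hp (losLead_mem 0)) (hp (losLead_mem 1))
  · exact mul_mem (hp (crossLead_mem 0)) (hp (crossLead_mem 1))
  · exact hp (sub_mem (mul_mem (losLead_mem 1) ((vecMem_pos 1).dot (vecMem_D 0)))
      (mul_mem ((vecMem_e 1).dot (vecMem_G 1)) (crossLead_mem 1)))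
  · exact hp (((vecMem_pos 0).sub (vecMem_pos 1)).dot ((vecMem_e 0).cross (vecMem_e 1)))
  · exact mul_mem (elim_mem 0 10) (elim_mem 1 10)
  · exact mul_mem (elimDisc_mem 0) (elimDisc_mem 1)

theorem isNondegenerate_of_genericity_ne_zero {d : Data} (h : d.genericity ≠ 0)
    (hN : d.DD ⬝ᵥ d.DD ≠ 0) : d.IsNondegenerate := by
  simp only [genericity, mul_ne_zero_iff] at h
  obtain ⟨⟨⟨⟨⟨⟨hl0, hl1⟩, hc0, hc1⟩, hdet⟩, hvol⟩, h10, h11⟩, hd0, hd1⟩ := h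
  refine ⟨hN, ?_, ?_, hdet, hvol,
    natDegree_eq_of_le_of_coeff_ne_zero (d.natDegree_elim_le 0) h10, ?_⟩
  · rw [Fin.forall_fin_two]; exact ⟨hl0, hl1⟩
  · rw [Fin.forall_fin_two]; exact ⟨hc0, hc1⟩
  · rw [Fin.forall_fin_two]; exact ⟨(separable_elim_iff h10).2 hd0, (separable_elim_iff h11).2 hd1⟩

end Data

/-! ### An explicit nondegenerate example -/

theorem eq_of_aevalAeval_eq {p q : ℝ[X][X]}
    (h : ∀ x y : ℝ, aevalAeval y x p = aevalAeval y x q) : p = q := by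
  refine Polynomial.funext fun r => Polynomial.funext fun s => ?_
  have key : ∀ p : ℝ[X][X], eval s (eval r p) = aevalAeval s (eval s r) p := by
    intro p
    induction p using Polynomial.induction_on' with
    | add p q hp hq => simp only [eval_add, map_add, hp, hq]
    | monomial n a =>
      rw [← C_mul_X_pow_eq_monomial, map_mul, map_pow, aevalAeval_C, aevalAeval_Y]
      simp [aeval_def, eval₂_eq_eval_map]
  rw [key, key, h]

namespace Data

/-- Data with nine distinct solutions. -/
noncomputable def sample : Data where
  att := ![⟨0, 0, 0, -1, by constructor <;> linarith [Real.pi_pos],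
      by constructor <;> linarith [Real.pi_pos]⟩,
    ⟨Real.pi / 2, 0, -1, 0, by constructor <;> linarith [Real.pi_pos],
      by constructor <;> linarith [Real.pi_pos]⟩]
  pos := ![![0, 1, 1], ![0, 0, -1]]
  vel := ![![0, 0, 0], ![0, -1, 1]]

theorem toVec_real (v : Fin 3 → ℝ) : toVec ℝ v = v := rfl

theorem sample_e_zero : sample.e 0 = ![1, 0, 0] := by
  simp [sample, e, Attributable.eRho, lineOfSight]

theorem sample_e_one : sample.e 1 = ![0, 1, 0] := by
  simp [sample, e, Attributable.eRho, lineOfSight]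

theorem sample_ePerp_zero : sample.ePerp 0 = ![0, 0, -1] := by
  simp [sample, ePerp, Attributable.ePerp, Attributable.eAlpha, Attributable.eDelta]

theorem sample_ePerp_one : sample.ePerp 1 = ![1, 0, 0] := by
  simp [sample, ePerp, Attributable.ePerp, Attributable.eAlpha, Attributable.eDelta]

theorem sample_pos_zero : sample.pos 0 = ![0, 1, 1] := rfl

theorem sample_pos_one : sample.pos 1 = ![0, 0, -1] := rfl

theorem sample_vel_zero : sample.vel 0 = ![0, 0, 0] := rfl

theorem sample_vel_one : sample.vel 1 = ![0, -1, 1] := rfl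

theorem sample_D_zero : sample.D 0 = ![0, 1, -1] := by
  simp [D, sample_pos_zero, sample_e_zero, cross_apply]

theorem sample_D_one : sample.D 1 = ![1, 0, 0] := by
  simp [D, sample_pos_one, sample_e_one, cross_apply]

theorem sample_DD : sample.DD = ![0, -1, -1] := by
  simp [DD, sample_D_zero, sample_D_one, cross_apply]

theorem sample_E_zero : sample.E 0 = ![0, 1, 0] := by
  simp [E, sample_ePerp_zero, sample_e_zero, cross_apply]

theorem sample_E_one : sample.E 1 = ![0, 0, -1] := by
  simp [E, sample_ePerp_one, sample_e_one, cross_apply]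

theorem sample_F_zero : sample.F 0 = ![-1, 0, 0] := by
  simp [F, sample_pos_zero, sample_vel_zero, sample_ePerp_zero, sample_e_zero, cross_apply]

theorem sample_F_one : sample.F 1 = ![1, -1, 0] := by
  simp [F, sample_pos_one, sample_vel_one, sample_ePerp_one, sample_e_one, cross_apply]

theorem sample_G_zero : sample.G 0 = ![0, 0, 0] := by
  simp [G, sample_pos_zero, sample_vel_zero, cross_apply]

theorem sample_G_one : sample.G 1 = ![-1, 0, 0] := by
  simp [G, sample_pos_one, sample_vel_one, cross_apply]

theorem sample_J (x y : ℝ) : sample.J x y = ![y - 1 + x, -y - x ^ 2, -y ^ 2] := by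
  simp only [J, angQuad, sample_E_zero, sample_E_one, sample_F_zero, sample_F_one, sample_G_zero,
    sample_G_one]
  apply vec_three_ext <;> simp [toVec]
  ring

theorem sample_q (x y : ℝ) : sample.q x y = x ^ 2 + y ^ 2 + y := by
  simp [q, sample_J, sample_DD, toVec_real]
  ring

theorem sample_r_zero (x y : ℝ) : sample.r 0 x y = ![x, 1, 1] := by
  apply vec_three_ext <;> simp [r, sample_pos_zero, sample_e_zero, toVec]

theorem sample_r_one (x y : ℝ) : sample.r 1 x y = ![0, y, -1] := by
  apply vec_three_ext <;> simp [r, sample_pos_one, sample_e_one, toVec]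

theorem sample_ρdot_zero (x y : ℝ) : sample.ρdot 0 x y = (y ^ 2 - y - x ^ 2) / 2 := by
  simp [ρdot, sample_J, sample_DD, sample_D_one, cross_apply, toVec_real]
  ring

theorem sample_ρdot_one (x y : ℝ) : sample.ρdot 1 x y = 1 - x - y := by
  simp [ρdot, sample_J, sample_DD, sample_D_zero, cross_apply, toVec_real]
  ring

theorem sample_rdot_zero (x y : ℝ) : sample.rdot 0 x y = ![(y ^ 2 - y - x ^ 2) / 2, 0, -x] := by
  apply vec_three_ext <;>
    simp [rdot, sample_ρdot_zero, sample_vel_zero, sample_e_zero, sample_ePerp_zero, toVec]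

theorem sample_rdot_one (x y : ℝ) : sample.rdot 1 x y = ![y, -x - y, 1] := by
  apply vec_three_ext <;>
    simp [rdot, sample_ρdot_one, sample_vel_one, sample_e_one, sample_ePerp_one, toVec]
  ring

/-- The right-hand side is the division by the circle `q` with respect to `x`, so that the resultant
can be read off from the linear remainder. -/
theorem sample_p_zero (x y : ℝ) : sample.p 0 x y =
    (2 + 2 * y ^ 2) * x + (1 - y - 4 * y ^ 2 + y ^ 4 - y ^ 5) / 2 + (x ^ 2 + y ^ 2 + y) *
      (((5 - 3 * y) * x ^ 2 + (8 + 9 * y - 10 * y ^ 2 + 5 * y ^ 3)) / 8) := by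
  simp [p, ξ, K, sample_r_zero, sample_r_one, sample_rdot_zero, sample_rdot_one, sample_e_zero,
    toVec_real, cross_apply]
  ring

theorem sample_p_one (x y : ℝ) : sample.p 1 x y =
    (-1 + 2 * y + 2 * y ^ 2 - 2 * y ^ 3 + y ^ 4) / 2 * x + (2 * y + 2 * y ^ 3)
      + (x ^ 2 + y ^ 2 + y) * ((-x ^ 3 + (3 * y - y ^ 2) * x) / 8) := by
  simp [p, ξ, K, sample_r_zero, sample_r_one, sample_rdot_zero, sample_rdot_one, sample_e_one,
    toVec_real, cross_apply]
  ring

theorem sample_qPoly : sample.qPoly = X ^ 2 + C (X ^ 2 + X) := by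
  refine eq_of_aevalAeval_eq fun x y => ?_
  rw [qPoly, map_q, aevalAeval_Y, aevalAeval_X, sample_q]
  simp
  ring

theorem sample_pPoly_zero : sample.pPoly 0 = C (2 + 2 * X ^ 2) * X
    + C (C (1 / 2) * (1 - X - 4 * X ^ 2 + X ^ 4 - X ^ 5))
    + sample.qPoly * (C (C (1 / 8) * (5 - 3 * X)) * X ^ 2
      + C (C (1 / 8) * (8 + 9 * X - 10 * X ^ 2 + 5 * X ^ 3))) := by
  refine eq_of_aevalAeval_eq fun x y => ?_
  rw [pPoly, map_p, aevalAeval_Y, aevalAeval_X, sample_p_zero, sample_qPoly]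
  simp
  ring

theorem sample_pPoly_one : sample.pPoly 1 =
    C (C (1 / 2) * (-1 + 2 * X + 2 * X ^ 2 - 2 * X ^ 3 + X ^ 4)) * X + C (2 * X + 2 * X ^ 3)
    + sample.qPoly * (C (-C (1 / 8)) * X ^ 3 + C (C (1 / 8) * (3 * X - X ^ 2)) * X) := by
  refine eq_of_aevalAeval_eq fun x y => ?_
  rw [pPoly, map_p, aevalAeval_Y, aevalAeval_X, sample_p_one, sample_qPoly]
  simp
  ring

/-- The polynomial of the values of `ρ₂` at the nine solutions for the sample data. -/
noncomputable def sampleFactor : ℝ[X] :=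
  X ^ 9 - 3 * X ^ 8 + 4 * X ^ 7 + 4 * X ^ 6 + 6 * X ^ 5 + 6 * X ^ 4 + 44 * X ^ 3 - 4 * X ^ 2
    + 13 * X + 1

theorem sample_coeff_two : sample.qPoly.coeff 2 = 1 := by
  rw [sample_qPoly, coeff_add, coeff_X_pow, coeff_C]
  simp

theorem sample_coeff_one : sample.qPoly.coeff 1 = 0 := by
  rw [sample_qPoly, coeff_add, coeff_X_pow, coeff_C]
  simp

theorem sample_coeff_zero : sample.qPoly.coeff 0 = X ^ 2 + X := by
  rw [sample_qPoly, coeff_add, coeff_X_pow, coeff_C]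
  simp

/-- The additional root `-1` is that of `crossTerm 1`, which equals `y + 1` here; for the other
eliminant it is the root `0` of `losMomentum 1`, which equals `-y`. -/
theorem sample_elim_zero : sample.elim 0 = C (1 / 4) * ((X - C (-1)) * sampleFactor) := by
  have h := resultant_of_eq_linear_add_mul (k := 4) sample.natDegree_qPoly_le (by
    have : (C (C (1 / 8 : ℝ) * (5 - 3 * X)) * X ^ 2
      + C (C (1 / 8) * (8 + 9 * X - 10 * X ^ 2 + 5 * X ^ 3)) : ℝ[X][X]).natDegree ≤ 2 := by
      compute_degree
    lia) sample_pPoly_zero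
  rw [sample_coeff_two, sample_coeff_one, sample_coeff_zero] at h
  rw [elim, show (5 : ℕ) = 1 + 4 from rfl, h, sampleFactor]
  refine Polynomial.funext fun y => ?_
  simp
  ring

theorem sample_elim_one : sample.elim 1 = C (1 / 4) * ((X - C 0) * sampleFactor) := by
  have h := resultant_of_eq_linear_add_mul (k := 4) sample.natDegree_qPoly_le (by
    have : (C (-C (1 / 8 : ℝ)) * X ^ 3 + C (C (1 / 8) * (3 * X - X ^ 2)) * X : ℝ[X][X]).natDegree
        ≤ 3 := by
      compute_degree
    lia) sample_pPoly_one
  rw [sample_coeff_two, sample_coeff_one, sample_coeff_zero] at h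
  rw [elim, show (5 : ℕ) = 1 + 4 from rfl, h, sampleFactor]
  refine Polynomial.funext fun y => ?_
  simp
  ring

/-- An explicit Bézout identity between the polynomial and its derivative, with a common denominator
extracted. -/
theorem sampleFactor_separable : sampleFactor.Separable := by
  refine ⟨C (1 / 1494956995200) * (272141297278 - 1394644387207 * X - 178061657887 * X ^ 2
      - 268584908245 * X ^ 3 - 259249124860 * X ^ 4 - 328863772201 * X ^ 5
      + 276795250071 * X ^ 6 - 99319029507 * X ^ 7),
    C (1 / 1494956995200) * (94062745994 - 106976193035 * X + 471147066554 * X ^ 2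
      + 51009226224 * X ^ 3 + 56332217817 * X ^ 4 + 42783416913 * X ^ 5
      + 46792095062 * X ^ 6 - 34433510360 * X ^ 7 + 11035447723 * X ^ 8), ?_⟩
  refine Polynomial.funext fun y => ?_
  simp [sampleFactor]
  ring

theorem separable_mul_of_eval_ne_zero {c a : ℝ} {w : ℝ[X]} (hc : c ≠ 0) (hw : w.Separable)
    (ha : w.eval a ≠ 0) : (C c * ((X - C a) * w)).Separable := by
  have hcop : IsCoprime (X - C a) w :=
    (irreducible_X_sub_C a).coprime_iff_not_dvd.2 fun h => ha (dvd_iff_isRoot.1 h)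
  exact ((separable_C c).2 hc.isUnit).mul (separable_X_sub_C.mul hw hcop)
    ⟨C c⁻¹, 0, by rw [← C_mul, inv_mul_cancel₀ hc, C_1, zero_mul, add_zero]⟩

theorem sampleFactor_natDegree : sampleFactor.natDegree = 9 := by
  rw [sampleFactor]
  compute_degree!

theorem coeff_mul_ne_zero {c a : ℝ} {w : ℝ[X]} (hc : c ≠ 0) (hw : w.natDegree = 9) :
    (C c * ((X - C a) * w)).coeff 10 ≠ 0 := by
  have hw0 : w ≠ 0 := ne_zero_of_natDegree_gt (n := 0) (by lia)
  have h : (C c * ((X - C a) * w)).natDegree = 10 := by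
    rw [natDegree_C_mul hc, natDegree_mul (X_sub_C_ne_zero a) hw0, natDegree_X_sub_C, hw]
  rw [← h, coeff_natDegree, leadingCoeff_ne_zero]
  exact mul_ne_zero (C_ne_zero.2 hc) (mul_ne_zero (X_sub_C_ne_zero a) hw0)

theorem sample_coeff_elim_ne_zero (j : Fin 2) : (sample.elim j).coeff 10 ≠ 0 := by
  fin_cases j
  · change (sample.elim 0).coeff 10 ≠ 0
    rw [sample_elim_zero]
    exact coeff_mul_ne_zero (by norm_num) sampleFactor_natDegree
  · change (sample.elim 1).coeff 10 ≠ 0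
    rw [sample_elim_one]
    exact coeff_mul_ne_zero (by norm_num) sampleFactor_natDegree

theorem sample_elimDisc_ne_zero (j : Fin 2) : sample.elimDisc j ≠ 0 := by
  rw [← separable_elim_iff (sample_coeff_elim_ne_zero j)]
  fin_cases j
  · change (sample.elim 0).Separable
    rw [sample_elim_zero]
    exact separable_mul_of_eval_ne_zero (by norm_num) sampleFactor_separable
      (by norm_num [sampleFactor])
  · change (sample.elim 1).Separable
    rw [sample_elim_one]
    exact separable_mul_of_eval_ne_zero (by norm_num) sampleFactor_separable
      (by norm_num [sampleFactor])

theorem sample_genericity_ne_zero : sample.genericity ≠ 0 := by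
  refine mul_ne_zero (mul_ne_zero (mul_ne_zero ?_ ?_)
    (mul_ne_zero (sample_coeff_elim_ne_zero 0) (sample_coeff_elim_ne_zero 1)))
    (mul_ne_zero (sample_elimDisc_ne_zero 0) (sample_elimDisc_ne_zero 1))
  · simp [losLead, crossLead, sample_e_zero, sample_e_one, sample_pos_zero, sample_pos_one,
      sample_ePerp_zero, sample_ePerp_one, sample_D_zero, sample_D_one, sample_G_one, cross_apply]
  · rw [sample_pos_zero, sample_pos_one, sample_e_zero, sample_e_one]
    simp [cross_apply]

theorem sample_DD_ne_zero : sample.DD ⬝ᵥ sample.DD ≠ 0 := by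
  rw [sample_DD]
  norm_num

end Data

end Linkage

theorem mainTheorem1 :
    Linkage.Generically fun d =>
      d.solutions.Nonempty ∧
      (d.u 0).natDegree = 10 ∧
      (d.u 1).natDegree = 10 ∧
      (EuclideanDomain.gcd (d.u 0) (d.u 1)).natDegree = 9 ∧
      Set.BijOn Prod.snd d.solutions
        {ρ₂ : ℂ | Polynomial.aeval ρ₂ (d.u 0) = 0 ∧ Polynomial.aeval ρ₂ (d.u 1) = 0} ∧
      d.solutions.encard = 9 :=
  Linkage.Data.generically_of_regular Linkage.Data.genericity_mem
    Linkage.Data.sample_genericity_ne_zero Linkage.Data.sample_DD_ne_zero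
    fun _ h hN => (Linkage.Data.isNondegenerate_of_genericity_ne_zero h hN).main
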